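/- Let $X$ be a metric space. A sequence in $X$ is a tuple $\boldsymbol{x}=(x_0,\dots,x_n)$, $n\ge 0$, with $x_{i-1}\neq x_i$ for all $i$; its length is $d(\boldsymbol{x})=\sum_{i=1}^n d(x_{i-1},x_i)$ (the same formula is used for arbitrary tuples). The point $x_k$ of a tuple is smooth if $1\le k\le n-1$ and $d(x_{k-1},x_k)+d(x_k,x_{k+1})=d(x_{k-1},x_{k+1})$, and singular otherwise. The frame $\varphi(\boldsymbol{x})$ is the subtuple of singular points, and a singular sequence is a sequence all of whose points are singular. A 4-cut is a sequence $(x_0,x_1,x_2,x_3)$ with $d(x_0,x_3)<d(x_0,x_1,x_2,x_3)=d(x_0,x_2,x_3)=d(x_0,x_1,x_3)$; $m_X\in[0,\infty]$ is the infimum of the lengths of all 4-cuts ($m_X=\infty$ if there are none). Order $X\times\mathbb{R}$ by $(x,t)\le(x',t')\iff d(x,x')\le t'-t$. For $a,b\in X$ and $\ell\ge 0$ let $\mathrm{Cau}^\ell(X;a,b)$ be the interval between $(a,0)$ and $(b,\ell)$, let $\Delta\mathrm{Cau}^\ell(X;a,b)$ be its order complex, and let $\dot\Delta\mathrm{Cau}^\ell(X;a,b)$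 be the subcomplex of the chains $(x_0,t_0)<\dots<(x_n,t_n)$ with $d(x_0,\dots,x_n)<\ell$. With $|\cdot|$ denoting geometric realization (with the weak topology), put $$\mathcal{M}^\ell(X;a,b)=|\Delta\mathrm{Cau}^\ell(X;a,b)|\,/\,|\dot\Delta\mathrm{Cau}^\ell(X;a,b)|,$$ a pointed CW complex (with $Y/\emptyset=Y\sqcup\{*\}$). For a singular sequence $F=(a_0,\dots,a_m)$ with $d(F)=\ell<m_X$ let $S(X;F)$ be the set of simplices $(x_0,t_0)<\dots<(x_n,t_n)$ of $\Delta\mathrm{Cau}^\ell(X;a_0,a_m)$ with $\varphi(x_0,\dots,x_n)=F$; then $S(X;F)\cup\dot\Delta\mathrm{Cau}^\ell(X;a_0,a_m)$ is a simplicial complex, and we put $$\mathcal{M}^\ell(X;F)=|S(X;F)\cup\dot\Delta\mathrm{Cau}^\ell(X;a_0,a_m)|\,/\,|\dot\Delta\mathrm{Cau}^\ell(X;a_0,a_m)|.$$ Theorem. Let $X$ be a metric space, let $a,b\in X$, and suppose that $0<\ell<m_X$ and $d(a,b)\le\ell$. (1) There is a homeomorphism of pointed spaces $$\mathcal{M}^\ell(X;a,b)\approx\bigvee_{F}\mathcal{M}^\ell(X;F),$$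 where $F$ runs over all singular sequences of length $\ell$ from $a$ to $b$ (the empty wedge is a point). (2) For every singular sequence $F=(a_0,\dots,a_m)$ of length $\ell$ from $a$ to $b$ there is a homotopy equivalence of pointed spaces $$\mathcal{M}^{\ell}(X;F)\simeq\bigwedge_{i=1}^m\mathcal{M}^{d(a_{i-1},a_i)}(X;a_{i-1},a_i),$$ where the smash product is that of pointed CW complexes, i.e. it is formed from the product with the compactly generated topology. -/

import Mathlib

noncomputable section

namespace MagnitudeHomotopy

universe u v

/-! ## Sequences in a metric space -/

section Sequences

variable {X : Type u} [MetricSpace X]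

/-- The length `d(x₀, …, xₙ) = ∑ d(xᵢ₋₁, xᵢ)` of a finite list of points. -/
def pathLength : List X → ℝ
  | [] => 0
  | [_] => 0
  | x :: y :: l => dist x y + pathLength (y :: l)

/-- A sequence is a nonempty list of points in which consecutive points are distinct. -/
def IsSequence (l : List X) : Prop :=
  l ≠ [] ∧ l.IsChain (· ≠ ·)

/-- A `4`-cut is a sequence `(x₀, x₁, x₂, x₃)` with
`d(x₀, x₃) < d(x₀, x₁, x₂, x₃) = d(x₀, x₂, x₃) = d(x₀, x₁, x₃)`. -/
def IsFourCut (x₀ x₁ x₂ x₃ : X) : Prop :=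
  IsSequence [x₀, x₁, x₂, x₃] ∧
  dist x₀ x₃ < pathLength [x₀, x₁, x₂, x₃] ∧
  pathLength [x₀, x₁, x₂, x₃] = pathLength [x₀, x₂, x₃] ∧
  pathLength [x₀, x₁, x₂, x₃] = pathLength [x₀, x₁, x₃]

variable (X) in
/-- `m_X`: the infimum of the lengths of all `4`-cuts of `X`; it is `⊤` if there are none. -/
def fourCutInf : EReal :=
  sInf {r : EReal | ∃ x₀ x₁ x₂ x₃ : X, IsFourCut x₀ x₁ x₂ x₃ ∧
    r = (pathLength [x₀, x₁, x₂, x₃] : ℝ)}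

/-- The middle point `y` of three successive points `x, y, z` is smooth if
`d(x, y, z) = d(x, z)`; it is singular otherwise. -/
def IsSmooth (x y z : X) : Prop :=
  dist x y + dist y z = dist x z

open Classical in
/-- The list of the singular points of a list of points, its initial point excepted. A point with a
predecessor and a successor is kept exactly when it is not smooth; the last point is kept. -/
def singularTail : List X → List X
  | [] => []
  | [_] => []
  | [_, y] => [y]
  | x :: y :: z :: l =>
      if IsSmooth x y z then singularTail (y :: z :: l) else y :: singularTail (y :: z :: l)

/-- The frame `φ(x₀, …, xₙ)`: the list of the singular points of `(x₀, …, xₙ)`, in order. The two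
end points are always singular. -/
def frame : List X → List X
  | [] => []
  | x :: l => x :: singularTail (x :: l)

/-- A singular sequence: a sequence all of whose points are singular. -/
def IsSingularSequence (l : List X) : Prop :=
  IsSequence l ∧ ∀ x y z : X, [x, y, z] <:+: l → ¬ IsSmooth x y z

/-- The singular sequences `F = (a₀, …, aₘ)` from `a₀ = a` to `aₘ = b` of length `d(F) = ℓ`. -/
@[ext]
structure Frame (a b : X) (ℓ : ℝ) where
  /-- the underlying list `(a₀, …, aₘ)` -/
  toList : List X
  isSingularSequence : IsSingularSequence toList
  head_eq : toList.head? = some a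
  last_eq : toList.getLast? = some b
  length_eq : pathLength toList = ℓ

/-- The number `m` of steps of the frame `F = (a₀, …, aₘ)`. -/
def Frame.steps {a b : X} {ℓ : ℝ} (F : Frame a b ℓ) : ℕ :=
  F.toList.length - 1

/-- For `i < m`, the starting point `aᵢ` of the step of `F = (a₀, …, aₘ)` from `aᵢ` to `aᵢ₊₁`. -/
def Frame.source {a b : X} {ℓ : ℝ} (F : Frame a b ℓ) (i : Fin F.steps) : X :=
  F.toList[i.val]'(by have := i.isLt; unfold Frame.steps at this; omega)

/-- For `i < m`, the end point `aᵢ₊₁` of the step of `F = (a₀, …, aₘ)` from `aᵢ` to `aᵢ₊₁`. -/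
def Frame.target {a b : X} {ℓ : ℝ} (F : Frame a b ℓ) (i : Fin F.steps) : X :=
  F.toList[i.val + 1]'(by have := i.isLt; unfold Frame.steps at this; omega)

end Sequences

/-! ## The causal order on `X × ℝ` -/

/-- The set `X × ℝ`, to be ordered by the causal order. -/
@[ext]
structure Spacetime (X : Type u) where
  /-- the position -/
  point : X
  /-- the time -/
  time : ℝ

/-- The causal order: `(x, t) ≤ (x', t')` if and only if `d(x, x') ≤ t' - t`. -/
instance {X : Type u} [MetricSpace X] : PartialOrder (Spacetime X) where
  le p q := dist p.point q.point ≤ q.time - p.time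
  le_refl p := by simp
  le_trans p q r hpq hqr := by
    have := dist_triangle p.point q.point r.point
    linarith
  le_antisymm p q hpq hqp := by
    have h0 : 0 ≤ dist p.point q.point := dist_nonneg
    have h1 : dist q.point p.point = dist p.point q.point := dist_comm _ _
    have h2 : dist p.point q.point = 0 := by linarith
    exact Spacetime.ext (dist_eq_zero.mp h2) (by linarith)

/-- The causal interval `Cau^ℓ(X; a, b) = {(x, t) ∣ (a, 0) ≤ (x, t) ≤ (b, ℓ)}`. -/
def Cau {X : Type u} [MetricSpace X] (a b : X) (ℓ : ℝ) : Set (Spacetime X) :=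
  Set.Icc ⟨a, 0⟩ ⟨b, ℓ⟩

/-! ## Simplicial complexes and their geometric realizations -/

section Realization

variable {V : Type u}

/-- The order complex `Δ P` of a subset `P` of a partially ordered set: the simplices are the
nonempty finite chains in `P`. -/
def orderComplex [PartialOrder V] (P : Set V) : PreAbstractSimplicialComplex V where
  faces := {s | s.Nonempty ∧ (s : Set V) ⊆ P ∧ IsChain (· ≤ ·) (s : Set V)}
  isRelLowerSet_faces := by
    rintro s ⟨hs, hP, hc⟩
    refine ⟨hs, fun t hts ht => ⟨ht, fun x hx => hP (hts hx), hc.mono fun x hx => hts hx⟩⟩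

/-- The points of the geometric realization `|K|`, in barycentric coordinates: finitely supported
families of nonnegative weights with sum `1` whose support is a simplex of `K`. -/
@[ext]
structure Realization (K : PreAbstractSimplicialComplex V) where
  /-- the barycentric coordinates -/
  weight : V →₀ ℝ
  nonneg : ∀ v, 0 ≤ weight v
  sum_eq_one : (weight.sum fun _ r => r) = 1
  support_mem : weight.support ∈ K

/-- The inclusion of the closed simplex with vertex set `s ∈ K` into `|K|`. -/
def Realization.ofSimplex {K : PreAbstractSimplicialComplex V} (s : Finset V) (hs : s ∈ K)
    (x : stdSimplex ℝ s) : Realization K where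
  weight := Finsupp.embDomain (Function.Embedding.subtype (· ∈ s))
    (Finsupp.equivFunOnFinite.symm x.1)
  nonneg v := by
    by_cases hv : v ∈ s
    · have := Finsupp.embDomain_apply_self (Function.Embedding.subtype (· ∈ s))
        (Finsupp.equivFunOnFinite.symm x.1) ⟨v, hv⟩
      simp only [Function.Embedding.subtype_apply] at this
      rw [this]
      exact x.2.1 _
    · rw [Finsupp.embDomain_of_notMem_range]
      simpa using hv
  sum_eq_one := by
    rw [Finsupp.sum_embDomain, Finsupp.sum_fintype _ _ (fun _ => rfl)]
    exact x.2.2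
  support_mem := by
    refine (K.isRelLowerSet_faces hs).2 ?_ ?_
    · intro v hv
      rw [Finsupp.support_embDomain, Finset.mem_map] at hv
      obtain ⟨w, -, rfl⟩ := hv
      exact w.2
    · rw [Finsupp.support_embDomain, Finset.map_nonempty, Finsupp.support_nonempty_iff]
      intro h0
      have h1 : ∀ i, x.1 i = 0 := fun i => DFunLike.congr_fun h0 i
      have h2 := x.2.2
      simp [h1] at h2

/-- The weak topology on `|K|`: a set is open if and only if its intersection with every closed
simplex (with its Euclidean topology) is open. -/
instance (K : PreAbstractSimplicialComplex V) : TopologicalSpace (Realization K) :=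
  ⨆ s : {s : Finset V // s ∈ K},
    TopologicalSpace.coinduced (Realization.ofSimplex s.1 s.2) inferInstance

/-- For a subcomplex `L` of `K`, the subspace `|L|` of `|K|`. -/
def Realization.sub {K : PreAbstractSimplicialComplex V} (L : PreAbstractSimplicialComplex V) :
    Set (Realization K) :=
  {p | p.weight.support ∈ L}

end Realization

/-! ## Pointed spaces: quotients, wedges, smash products, homotopy equivalences -/

section Pointed

/-- The relation that identifies every point of `A` with the added point. -/
def collapseRel {Y : Type u} (A : Set Y) : Y ⊕ Unit → Y ⊕ Unit → Prop :=
  fun p q => (∃ y ∈ A, p = Sum.inl y) ∧ q = Sum.inr ()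

/-- The pointed quotient space `Y / A`: a base point is added to `Y` as an isolated point, and then
all points of `A` are identified with it. If `A` is nonempty, this is the usual quotient in which
`A` becomes one point; and `Y / ∅ = Y ⊔ {*}`. -/
def Collapse {Y : Type u} (A : Set Y) : Type u :=
  Quot (collapseRel A)

instance {Y : Type u} [TopologicalSpace Y] (A : Set Y) : TopologicalSpace (Collapse A) :=
  inferInstanceAs (TopologicalSpace (Quot (collapseRel A)))

/-- The base point of `Y / A`. -/
def Collapse.pt {Y : Type u} (A : Set Y) : Collapse A :=
  Quot.mk _ (Sum.inr ())

/-- The subset of the disjoint union of pointed spaces that consists of the base points. -/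
def basePoints {ι : Type u} {M : ι → Type v} (pt : ∀ i, M i) : Set (Σ i, M i) :=
  {p | p.2 = pt p.1}

/-- The wedge sum `⋁ᵢ Mᵢ`: the disjoint union with all base points identified (a point, if there
are no summands). -/
abbrev Wedge {ι : Type u} {M : ι → Type v} (pt : ∀ i, M i) : Type (max u v) :=
  Collapse (basePoints pt)

/-- The base point of the wedge sum. -/
def Wedge.pt {ι : Type u} {M : ι → Type v} (pt : ∀ i, M i) : Wedge pt :=
  Collapse.pt _

/-- The fat wedge: the points of the product that have a coordinate equal to the base point. The
product carries the compactly generated topology, as is usual for products of CW complexes. -/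
def fatWedge {ι : Type u} {M : ι → Type v} (pt : ∀ i, M i) :
    Set (CompactCoherentification (∀ i, M i)) :=
  {f | ∃ i, (CompactCoherentification.mk (∀ i, M i)).symm f i = pt i}

/-- The smash product `⋀ᵢ Mᵢ` of finitely many pointed spaces: the product (with the compactly
generated topology) modulo the fat wedge. -/
abbrev Smash {ι : Type u} [Finite ι] {M : ι → Type v} (pt : ∀ i, M i) : Type (max u v) :=
  Collapse (fatWedge pt)

/-- The base point of the smash product. -/
def Smash.pt {ι : Type u} [Finite ι] {M : ι → Type v} (pt : ∀ i, M i) : Smash pt :=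
  Collapse.pt _

/-- `(M, x) ≈ (N, y)`: there is a homeomorphism that respects the base points. -/
def PointedHomeomorphic {M : Type u} {N : Type v} [TopologicalSpace M] [TopologicalSpace N]
    (x : M) (y : N) : Prop :=
  ∃ h : M ≃ₜ N, h x = y

/-- `(M, x) ≃ (N, y)`: there is a homotopy equivalence of pointed spaces. -/
def PointedHomotopyEquivalent {M : Type u} {N : Type v} [TopologicalSpace M] [TopologicalSpace N]
    (x : M) (y : N) : Prop :=
  ∃ (f : C(M, N)) (g : C(N, M)), f x = y ∧ g y = x ∧
    (g.comp f).HomotopicRel (ContinuousMap.id M) {x} ∧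
    (f.comp g).HomotopicRel (ContinuousMap.id N) {y}

end Pointed

/-! ## The magnitude homotopy type -/

section Magnitude

variable {X : Type u} [MetricSpace X]

/-- `l = ((x₀, t₀), …, (xₙ, tₙ))` lists the elements of the finite chain `s` in increasing order. -/
def Enumerates (l : List (Spacetime X)) (s : Finset (Spacetime X)) : Prop :=
  l.Pairwise (· < ·) ∧ ∀ p, p ∈ l ↔ p ∈ s

/-- The sequence of points `(x₀, …, xₙ)` of a causal sequence `((x₀, t₀), …, (xₙ, tₙ))`. -/
def points (l : List (Spacetime X)) : List X :=
  l.map Spacetime.point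

theorem pathLength_nonneg : ∀ l : List X, 0 ≤ pathLength l
  | [] => le_rfl
  | [_] => le_rfl
  | x :: y :: l => by
      have := pathLength_nonneg (y :: l)
      have := dist_nonneg (x := x) (y := y)
      simp only [pathLength]; linarith

theorem pathLength_cons_cons_le (x y : X) (l : List X) :
    pathLength (x :: l) ≤ dist x y + pathLength (y :: l) := by
  cases l with
  | nil => simp [pathLength]
  | cons z l =>
    have := dist_triangle x y z
    simp only [pathLength]; linarith

theorem pathLength_le_cons (x : X) (l : List X) : pathLength l ≤ pathLength (x :: l) := by
  cases l with
  | nil => simp [pathLength]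
  | cons z l => simp only [pathLength]; linarith [dist_nonneg (x := x) (y := z)]

theorem pathLength_cons_sublist {l' l : List X} (h : l'.Sublist l) :
    ∀ x, pathLength (x :: l') ≤ pathLength (x :: l) := by
  induction h with
  | slnil => intro x; exact le_rfl
  | @cons l' l y _ ih =>
    intro x
    have h1 := ih y
    have h2 := pathLength_cons_cons_le x y l'
    simp only [pathLength]; linarith
  | cons_cons y _ ih => intro x; have := ih y; simp only [pathLength]; linarith

theorem pathLength_sublist {l' l : List X} (h : l'.Sublist l) : pathLength l' ≤ pathLength l := by
  induction h with
  | slnil => exact le_rfl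
  | cons y _ ih => exact ih.trans (pathLength_le_cons _ _)
  | cons_cons y h _ => exact pathLength_cons_sublist h y

theorem singularTail_sublist : ∀ (x : X) (l : List X), (singularTail (x :: l)).Sublist l
  | _, [] => by simp [singularTail]
  | _, [y] => by simp [singularTail]
  | x, y :: z :: l => by
      have h := singularTail_sublist y (z :: l)
      simp only [singularTail]
      split_ifs
      · exact h.trans (List.sublist_cons_self _ _)
      · exact h.cons_cons y

theorem frame_sublist : ∀ l : List X, (frame l).Sublist l
  | [] => by simp [frame]
  | x :: l => (singularTail_sublist x l).cons_cons x

theorem isSmooth_of_isSmooth {x y z w : X} (hxy : x ≠ y) (hyz : y ≠ z) (hzw : z ≠ w)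
    (h1 : IsSmooth x y z) (h2 : IsSmooth y z w)
    (hm : ((dist x y + dist y z + dist z w : ℝ) : EReal) < fourCutInf X) :
    IsSmooth x y w ∧ IsSmooth x z w := by
  unfold IsSmooth at *
  have ht1 := dist_triangle x y w
  have hkey : dist x w = dist x y + dist y z + dist z w := by
    by_contra hne
    refine absurd hm (not_lt.mpr (sInf_le ⟨x, y, z, w, ⟨⟨by simp, by simp [hxy, hyz, hzw]⟩, ?_⟩, ?_⟩))
    · refine ⟨?_, ?_, ?_⟩ <;> simp only [pathLength]
      · exact lt_of_le_of_ne (by linarith) (fun h => hne (by linarith))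
      · linarith
      · linarith
    · simp only [pathLength]
      congr 1
      ring
  constructor <;> linarith

theorem singularTail_cons_cons_congr {x y : X} {l l' : List X}
    (hl : (y :: l).IsChain (· ≠ ·)) (hl' : (y :: l').IsChain (· ≠ ·)) (hxy : x ≠ y)
    (hsub : l'.Sublist l)
    (hlen : pathLength (y :: l') = pathLength (y :: l))
    (hm : ((dist x y + pathLength (y :: l) : ℝ) : EReal) < fourCutInf X)
    (ih : singularTail (y :: l') = singularTail (y :: l)) :
    singularTail (x :: y :: l') = singularTail (x :: y :: l) := by
  cases l with
  | nil => rw [List.sublist_nil.mp hsub]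
  | cons z s =>
    cases l' with
    | nil =>
      simp only [List.isChain_cons_cons] at hl
      have := pathLength_nonneg (z :: s)
      have := dist_pos.mpr hl.1
      simp only [pathLength] at hlen
      linarith
    | cons w s' =>
      simp only [List.isChain_cons_cons] at hl hl'
      have hiff : IsSmooth x y w ↔ IsSmooth x y z := by
        cases hsub with
        | cons_cons => exact Iff.rfl
        | cons _ hsub =>
          by_cases hzw : z = w
          · rw [hzw]
          have h1 := pathLength_cons_sublist hsub z
          have h2 := dist_triangle y z w
          have h3 := dist_triangle x z w
          have h4 := dist_triangle x y z
          have h5 := dist_triangle x y w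
          have h6 := pathLength_nonneg (w :: s')
          simp only [pathLength] at hlen h1 hm
          have hyzw : IsSmooth y z w := by unfold IsSmooth; linarith
          constructor
          · intro h; unfold IsSmooth at *; linarith
          · intro h
            refine (isSmooth_of_isSmooth hxy hl.1 hzw h hyzw (lt_of_le_of_lt ?_ hm)).1
            exact EReal.coe_le_coe_iff.mpr (by linarith)
      by_cases h : IsSmooth x y z
      · simp only [singularTail, hiff.mpr h, h, if_true, ih]
      · simp only [singularTail, mt hiff.mp h, h, if_false, ih]

/-- Below `m_X`, deleting points without shortening a sequence does not change the frame. -/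
theorem singularTail_eq_of_sublist {l l' : List X} (hsub : l'.Sublist l) :
    ∀ x, (x :: l).IsChain (· ≠ ·) → (x :: l').IsChain (· ≠ ·) →
      pathLength (x :: l') = pathLength (x :: l) →
      ((pathLength (x :: l) : ℝ) : EReal) < fourCutInf X →
      singularTail (x :: l') = singularTail (x :: l) := by
  induction hsub with
  | slnil => intros; rfl
  | @cons_cons l' l y hsub ih =>
    intro x hl hl' hlen hm
    rw [List.isChain_cons_cons] at hl hl'
    simp only [pathLength] at hlen hm
    have hlen' : pathLength (y :: l') = pathLength (y :: l) := by linarith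
    refine singularTail_cons_cons_congr hl.2 hl'.2 hl.1 hsub hlen' hm
      (ih y hl.2 hl'.2 hlen' (lt_of_le_of_lt ?_ hm))
    exact EReal.coe_le_coe_iff.mpr (by linarith [dist_nonneg (x := x) (y := y)])
  | @cons l' l y hsub ih =>
    intro x hl hl' hlen hm
    rw [List.isChain_cons_cons] at hl
    simp only [pathLength] at hlen hm
    have hpos := dist_pos.mpr hl.1
    have hle := pathLength_cons_sublist hsub y
    cases l' with
    | nil =>
      have := pathLength_nonneg (y :: l)
      simp only [pathLength] at hlen
      linarith
    | cons w s =>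
      rw [List.isChain_cons_cons] at hl'
      have htri := dist_triangle x y w
      have hxyw : IsSmooth x y w := by
        simp only [pathLength] at hlen hle; unfold IsSmooth; linarith
      have hlen' : pathLength (y :: w :: s) = pathLength (y :: l) := by
        simp only [pathLength] at hlen hle ⊢; linarith
      have hyw : y ≠ w := by
        rintro rfl
        cases l with
        | nil => simp at hsub
        | cons z t =>
          have hyz := (List.isChain_cons_cons.mp hl.2).1
          cases hsub with
          | cons_cons => exact hyz rfl
          | cons _ hsub =>
            have h1 := pathLength_cons_sublist hsub z
            have h2 := dist_pos.mpr hyz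
            have h3 := dist_nonneg (x := z) (y := y)
            simp only [pathLength, dist_self] at hlen' h1
            linarith
      have hchain : (y :: w :: s).IsChain (· ≠ ·) := List.isChain_cons_cons.mpr ⟨hyw, hl'.2⟩
      have hm' : ((pathLength (y :: l) : ℝ) : EReal) < fourCutInf X :=
        lt_of_le_of_lt (EReal.coe_le_coe_iff.mpr (by linarith)) hm
      rw [← singularTail_cons_cons_congr hl.2 hchain hl.1 hsub hlen' hm
        (ih y hl.2 hchain hlen' hm')]
      cases s with
      | nil => simp [singularTail, hxyw]
      | cons v s =>
        have hwv := (List.isChain_cons_cons.mp hl'.2).1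
        have hiff : IsSmooth x w v ↔ IsSmooth y w v := by
          constructor
          · intro h
            have h1 := dist_triangle x y v
            have h2 := dist_triangle y w v
            unfold IsSmooth at *; linarith
          · intro h
            refine (isSmooth_of_isSmooth hl.1 hyw hwv hxyw h (lt_of_le_of_lt ?_ hm)).2
            have := pathLength_nonneg (v :: s)
            simp only [pathLength] at hlen'
            exact EReal.coe_le_coe_iff.mpr (by linarith)
        by_cases h : IsSmooth y w v
        · simp only [singularTail, hxyw, if_true, hiff.mpr h, h]
        · simp only [singularTail, hxyw, if_true, mt hiff.mp h, h, if_false]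

theorem frame_eq_of_sublist {l l' : List X} (hsub : l'.Sublist l) (hl : l.IsChain (· ≠ ·))
    (hl' : l'.IsChain (· ≠ ·)) (hne : l' ≠ []) (hlen : pathLength l' = pathLength l)
    (hm : ((pathLength l : ℝ) : EReal) < fourCutInf X) : frame l' = frame l := by
  cases hsub with
  | slnil => rfl
  | cons_cons x hsub =>
    simp only [frame, singularTail_eq_of_sublist hsub x hl hl' hlen hm]
  | @cons l' l x hsub =>
    exfalso
    cases l with
    | nil => exact hne (List.sublist_nil.mp hsub)
    | cons y t =>
      have h1 := pathLength_sublist hsub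
      have h2 := dist_pos.mpr (List.isChain_cons_cons.mp hl).1
      have h3 : pathLength (x :: y :: t) = dist x y + pathLength (y :: t) := rfl
      linarith

theorem pathLength_points_le : ∀ (p q : Spacetime X) (l : List (Spacetime X)),
    (p :: l).Pairwise (· < ·) → (∀ r ∈ p :: l, r ≤ q) →
    pathLength (points (p :: l)) ≤ q.time - p.time
  | p, q, [], _, hq => by
      have h : dist p.point q.point ≤ q.time - p.time := hq p (by simp)
      have := dist_nonneg (x := p.point) (y := q.point)
      simp only [points, List.map_cons, List.map_nil, pathLength]; linarith
  | p, q, r :: l, h, hq => by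
      rw [List.pairwise_cons] at h
      have h1 := pathLength_points_le r q l h.2 (fun s hs => hq s (List.mem_cons_of_mem _ hs))
      have h2 : dist p.point r.point ≤ r.time - p.time := (h.1 r (by simp)).le
      simp only [points, List.map_cons, pathLength] at h1 ⊢; linarith

theorem isChain_points : ∀ (p q : Spacetime X) (l : List (Spacetime X)),
    (p :: l).Pairwise (· < ·) → (∀ r ∈ p :: l, r ≤ q) →
    q.time - p.time ≤ pathLength (points (p :: l)) →
    (points (p :: l)).IsChain (· ≠ ·)
  | p, q, [], _, _, _ => by simp [points]
  | p, q, r :: l, h, hq, hlen => by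
      rw [List.pairwise_cons] at h
      have hq' : ∀ s ∈ r :: l, s ≤ q := fun s hs => hq s (List.mem_cons_of_mem _ hs)
      have h1 := pathLength_points_le r q l h.2 hq'
      have h2 : p < r := h.1 r (by simp)
      have h3 : dist p.point r.point ≤ r.time - p.time := h2.le
      simp only [points, List.map_cons, pathLength] at h1 hlen
      have ih := isChain_points r q l h.2 hq' (by
        simp only [points, List.map_cons]; linarith)
      simp only [points, List.map_cons] at ih ⊢
      refine List.isChain_cons_cons.mpr ⟨fun heq => h2.ne (Spacetime.ext heq ?_), ih⟩
      rw [heq, dist_self] at h3 hlen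
      linarith

theorem causal_bounds {a b : X} {ℓ : ℝ} {l : List (Spacetime X)} {s : Finset (Spacetime X)}
    (he : Enumerates l s) (hs : s ∈ orderComplex (Cau a b ℓ)) :
    pathLength (points l) ≤ ℓ ∧
      (ℓ ≤ pathLength (points l) → (points l).IsChain (· ≠ ·)) := by
  have hmem : ∀ r ∈ l, r ∈ Cau a b ℓ := fun r hr => hs.2.1 ((he.2 r).mp hr)
  cases l with
  | nil =>
    obtain ⟨x, hx⟩ := hs.1
    exact absurd ((he.2 x).mpr hx) (by simp)
  | cons p l =>
    have hp : dist a p.point ≤ p.time - 0 := (hmem p (by simp)).1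
    have hp0 := dist_nonneg (x := a) (y := p.point)
    have hq : ∀ r ∈ p :: l, r ≤ (⟨b, ℓ⟩ : Spacetime X) := fun r hr => (hmem r hr).2
    have h1 : _ ≤ ℓ - p.time := pathLength_points_le p ⟨b, ℓ⟩ l he.1 hq
    exact ⟨by linarith, fun h => isChain_points p ⟨b, ℓ⟩ l he.1 hq
      (show ℓ - p.time ≤ _ by linarith)⟩

theorem Enumerates.exists_subset {l : List (Spacetime X)} {s t : Finset (Spacetime X)}
    (he : Enumerates l s) (hts : t ⊆ s) : ∃ l', l'.Sublist l ∧ Enumerates l' t := by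
  classical
  refine ⟨l.filter (· ∈ t), List.filter_sublist, he.1.filter _, fun p => ?_⟩
  simp only [List.mem_filter, decide_eq_true_eq, he.2]
  exact ⟨fun h => h.2, fun h => ⟨hts h, h⟩⟩

/-- `Δ Cau^ℓ(X; a, b)`: the order complex of the causal interval. -/
def causalComplex (a b : X) (ℓ : ℝ) : PreAbstractSimplicialComplex (Spacetime X) :=
  orderComplex (Cau a b ℓ)

/-- `Δ̇ Cau^ℓ(X; a, b)`: the subcomplex of the causal sequences `((x₀, t₀), …, (xₙ, tₙ))` with
`d(x₀, …, xₙ) < ℓ`. -/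
def shortComplex (a b : X) (ℓ : ℝ) : PreAbstractSimplicialComplex (Spacetime X) where
  faces := {s | s ∈ causalComplex a b ℓ ∧ ∃ l, Enumerates l s ∧ pathLength (points l) < ℓ}
  isRelLowerSet_faces := by
    rintro s ⟨hs, l, hl, hlen⟩
    have hlow := (causalComplex a b ℓ).isRelLowerSet_faces hs
    refine ⟨hlow.1, fun t hts ht => ⟨hlow.2 hts ht, ?_⟩⟩
    obtain ⟨l', hsub, hl'⟩ := hl.exists_subset hts
    exact ⟨l', hl', (pathLength_sublist (hsub.map _)).trans_lt hlen⟩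

/-- `S(X; F)`: the simplices of `Δ Cau^ℓ(X; a, b)` whose sequence of points has frame `F`. -/
def framedSimplices {a b : X} {ℓ : ℝ} (F : Frame a b ℓ) : Set (Finset (Spacetime X)) :=
  {s | s ∈ causalComplex a b ℓ ∧ ∃ l, Enumerates l s ∧ frame (points l) = F.toList}

/-- The simplicial complex `S(X; F) ∪ Δ̇ Cau^ℓ(X; a, b)`, for `ℓ = d(F) < m_X`. -/
def framedComplex {a b : X} {ℓ : ℝ} (hℓ : (ℓ : EReal) < fourCutInf X) (F : Frame a b ℓ) :
    PreAbstractSimplicialComplex (Spacetime X) where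
  faces := framedSimplices F ∪ (shortComplex a b ℓ).faces
  isRelLowerSet_faces := by
    rintro s (⟨hs, l, hl, hF⟩ | hs)
    · have hlow := (causalComplex a b ℓ).isRelLowerSet_faces hs
      refine ⟨hlow.1, fun t hts ht => ?_⟩
      have htc := hlow.2 hts ht
      obtain ⟨l', hsub, hl'⟩ := hl.exists_subset hts
      have hb := causal_bounds hl hs
      have hb' := causal_bounds hl' htc
      have hge : ℓ ≤ pathLength (points l) := by
        have := pathLength_sublist (frame_sublist (points l))
        rw [hF, F.length_eq] at this
        exact this
      rcases lt_or_ge (pathLength (points l')) ℓ with hlt | hge'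
      · exact Or.inr ⟨htc, l', hl', hlt⟩
      · refine Or.inl ⟨htc, l', hl', ?_⟩
        rw [← hF]
        refine frame_eq_of_sublist (hsub.map _) (hb.2 hge) (hb'.2 hge') ?_
          (le_antisymm (hb'.1.trans hge) (hb.1.trans hge')) ?_
        · obtain ⟨x, hx⟩ := ht
          have hx' := (hl'.2 x).mpr hx
          intro h0
          simp only [points, List.map_eq_nil_iff] at h0
          simp [h0] at hx'
        · rw [le_antisymm hb.1 hge]; exact hℓ
    · have hlow := (shortComplex a b ℓ).isRelLowerSet_faces hs
      exact ⟨hlow.1, fun t hts ht => Or.inr (hlow.2 hts ht)⟩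

/-- The magnitude homotopy type `M^ℓ(X; a, b) = |Δ Cau^ℓ(X; a, b)| / |Δ̇ Cau^ℓ(X; a, b)|`. -/
abbrev MagnitudeType (a b : X) (ℓ : ℝ) : Type u :=
  Collapse (Realization.sub (K := causalComplex a b ℓ) (shortComplex a b ℓ))

/-- The base point of `M^ℓ(X; a, b)`. -/
def MagnitudeType.pt (a b : X) (ℓ : ℝ) : MagnitudeType a b ℓ :=
  Collapse.pt _

/-- The magnitude homotopy type with frame `F`, for `ℓ = d(F) < m_X`:
`M^ℓ(X; F) = |S(X; F) ∪ Δ̇ Cau^ℓ(X; a, b)| / |Δ̇ Cau^ℓ(X; a, b)|`. -/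
abbrev FramedType {a b : X} {ℓ : ℝ} (hℓ : (ℓ : EReal) < fourCutInf X) (F : Frame a b ℓ) : Type u :=
  Collapse (Realization.sub (K := framedComplex hℓ F) (shortComplex a b ℓ))

/-- The base point of `M^ℓ(X; F)`. -/
def FramedType.pt {a b : X} {ℓ : ℝ} (hℓ : (ℓ : EReal) < fourCutInf X) (F : Frame a b ℓ) :
    FramedType hℓ F :=
  Collapse.pt _

end Magnitude

end MagnitudeHomotopy

end

/-! A simplex of the causal complex outside the short complex has length exactly `ℓ`. Below `m_X`,
deleting points without shortening a sequence does not change its frame (`frame_eq_of_sublist`).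
Deleting smooth points one at a time therefore shows that the frame is a singular sequence of length
`ℓ`. So the long simplices are partitioned by their frames, each class together with the short
simplices is a subcomplex, and the quotient is a wedge (`homeomorphWedge`).

For (2), a chain of length `ℓ` moves at unit speed, so the times of its points are forced. Hence a
simplex has frame `F` exactly when it contains the events `(aⱼ, d(a₀, …, aⱼ))`
(`Frame.mem_framedSimplices_iff`). Cutting it at these events gives one chain for each step, lying
in a time-translated copy of the causal interval of that step and containing both of its ends; any
such family of chains can be glued back. In the interval of a step, the chains that miss an end are
precisely the short ones (`mem_shortComplex_dist_iff`).

This situation is abstracted in `IsGlued`. Restricting barycentric coordinates to the pieces and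
normalizing them matches the points of `|K| / |L|` with those of the smash product; the inverse
rescales the pieces so that they agree at the shared vertices. The resulting map is even a
homeomorphism (`IsGlued.homeomorphSmash`). Normalization breaks down where weights vanish, so
continuity is obtained from the closed relation `IsGlued.Rel` between compact simplices and not from
formulas with quotients. -/

noncomputable section

namespace MagnitudeHomotopy

universe u v

/-! ### Pointed quotients and a continuity criterion -/

section Collapse

variable {Y : Type u} {W : Type v}

/-- If a function `g` is compatible, along a closed correspondence with a compact space, with a
continuous function, and is constant on a closed set outside of which the correspondence is
everywhere defined, then `g` is continuous. -/
theorem continuous_of_closed_correspondence {A B C : Type*} [TopologicalSpace A]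
    [TopologicalSpace B] [TopologicalSpace C] [CompactSpace B] {R : Set (A × B)} (hR : IsClosed R)
    {Z : Set A} (hZ : IsClosed Z) {g : A → C} {h : B → C} (hh : Continuous h) {c : C}
    (hc : ∀ a ∈ Z, g a = c) (hex : ∀ a ∉ Z, ∃ b, (a, b) ∈ R)
    (heq : ∀ a b, (a, b) ∈ R → g a = h b) : Continuous g := by
  refine continuous_iff_isClosed.mpr fun T hT => ?_
  -- The preimage of `T` is this projection, closed because `B` is compact, together with `Z` in
  -- case `c ∈ T`.
  have h1 : IsClosed (Prod.fst '' (R ∩ Prod.snd ⁻¹' (h ⁻¹' T))) :=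
    isClosedMap_fst_of_compactSpace _ (hR.inter ((hT.preimage hh).preimage continuous_snd))
  have h2 : IsClosed {a | a ∈ Z ∧ c ∈ T} := by
    by_cases hcT : c ∈ T <;> simp [hcT, hZ]
  convert h1.union h2 using 1
  ext a
  simp only [Set.mem_preimage, Set.mem_union, Set.mem_image, Set.mem_inter_iff, Prod.exists,
    exists_and_right, exists_eq_right, Set.mem_ofPred_eq]
  constructor
  · intro ha
    by_cases haZ : a ∈ Z
    · exact Or.inr ⟨haZ, hc a haZ ▸ ha⟩
    · obtain ⟨b, hb⟩ := hex a haZ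
      exact Or.inl ⟨b, hb, heq a b hb ▸ ha⟩
  · rintro (⟨b, hb, hbT⟩ | ⟨haZ, hcT⟩)
    · rw [heq a b hb]; exact hbT
    · rw [hc a haZ]; exact hcT

/-- The projection `Y → Y / A`. -/
def Collapse.mk (A : Set Y) (y : Y) : Collapse A :=
  Quot.mk _ (Sum.inl y)

theorem Collapse.mk_eq_pt {A : Set Y} {y : Y} (hy : y ∈ A) : Collapse.mk A y = Collapse.pt A :=
  Quot.sound ⟨⟨y, hy, rfl⟩, rfl⟩

theorem Collapse.eq_pt_or_exists {A : Set Y} (z : Collapse A) :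
    z = Collapse.pt A ∨ ∃ y ∉ A, Collapse.mk A y = z := by
  obtain ⟨y | y, rfl⟩ := Quot.exists_rep z
  · by_cases hy : y ∈ A
    · exact Or.inl (Collapse.mk_eq_pt hy)
    · exact Or.inr ⟨y, hy, rfl⟩
  · exact Or.inl rfl

/-- The map out of `Y / A` that sends the base point to `w` and is given by `f` on `Y`. -/
def Collapse.lift {A : Set Y} (f : Y → W) (w : W) (h : ∀ y ∈ A, f y = w) : Collapse A → W :=
  Quot.lift (Sum.elim f fun _ => w) (by rintro _ _ ⟨⟨y, hy, rfl⟩, rfl⟩; exact h y hy)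

@[simp]
theorem Collapse.lift_mk {A : Set Y} (f : Y → W) (w : W) (h : ∀ y ∈ A, f y = w) (y : Y) :
    Collapse.lift f w h (Collapse.mk A y) = f y :=
  rfl

@[simp]
theorem Collapse.lift_pt {A : Set Y} (f : Y → W) (w : W) (h : ∀ y ∈ A, f y = w) :
    Collapse.lift f w h (Collapse.pt A) = w :=
  rfl

/-- Membership in `A` is itself a function that descends to the quotient, with value `True` at the
base point. -/
theorem Collapse.mk_eq_pt_iff {A : Set Y} {y : Y} :
    Collapse.mk A y = Collapse.pt A ↔ y ∈ A := by
  refine ⟨fun h => ?_, Collapse.mk_eq_pt⟩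
  have := congrArg (Collapse.lift (A := A) (fun y => y ∈ A) True (by simp)) h
  simpa using this

theorem Collapse.mk_inj {A : Set Y} {y y' : Y} (hy : y ∉ A)
    (h : Collapse.mk A y = Collapse.mk A y') : y = y' := by
  have := congrArg (Collapse.lift (A := A) (fun z => z = y) False
    (fun z hz => eq_false fun hzy => hy (hzy ▸ hz))) h
  simpa [eq_comm] using this

variable [TopologicalSpace Y] [TopologicalSpace W]

theorem Collapse.continuous_mk (A : Set Y) : Continuous (Collapse.mk A) :=
  continuous_quot_mk.comp continuous_inl

theorem Collapse.continuous_lift {A : Set Y} {f : Y → W} (hf : Continuous f) (w : W)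
    (h : ∀ y ∈ A, f y = w) : Continuous (Collapse.lift f w h) :=
  continuous_quot_lift _ (hf.sumElim continuous_const)

/-- The preimage of `T` in `Y ⊕ Unit` misses the added point, so only its part in `Y` matters. -/
theorem Collapse.isClosed_iff_of_pt_notMem {A : Set Y} {T : Set (Collapse A)}
    (hT : Collapse.pt A ∉ T) : IsClosed T ↔ IsClosed (Collapse.mk A ⁻¹' T) := by
  refine ⟨fun h => h.preimage (Collapse.continuous_mk A), fun h => ?_⟩
  have h1 : IsClosed (Quot.mk (collapseRel A) ⁻¹' T) := by
    rw [isClosed_sum_iff]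
    refine ⟨h, ?_⟩
    convert isClosed_empty
    ext x
    exact iff_of_false (fun hx => hT hx) (by simp)
  exact (isQuotientMap_quot_mk (r := collapseRel A)).isClosed_preimage.mp h1

end Collapse

/-! ### Geometric realizations: coordinates, compact sets, separation -/

section Realization

variable {V : Type u} {K L : PreAbstractSimplicialComplex V}

theorem Realization.ofSimplex_weight {s : Finset V} (hs : s ∈ K) (x : stdSimplex ℝ s) (v : s) :
    (Realization.ofSimplex s hs x).weight v = x.1 v := by
  have := Finsupp.embDomain_apply_self (Function.Embedding.subtype (· ∈ s))
    (Finsupp.equivFunOnFinite.symm x.1) v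
  simpa [Realization.ofSimplex] using this

theorem Realization.ofSimplex_support_subset {s : Finset V} (hs : s ∈ K) (x : stdSimplex ℝ s) :
    (Realization.ofSimplex s hs x).weight.support ⊆ s := by
  intro v hv
  simp only [Realization.ofSimplex, Finsupp.support_embDomain, Finset.mem_map] at hv
  obtain ⟨w, -, rfl⟩ := hv
  exact w.2

theorem Realization.ofSimplex_injective {s : Finset V} (hs : s ∈ K) :
    Function.Injective (Realization.ofSimplex s hs) := by
  intro x y h
  ext v
  have h1 := Realization.ofSimplex_weight hs x v
  rw [h, Realization.ofSimplex_weight] at h1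
  exact h1.symm

theorem Realization.exists_ofSimplex_eq {s : Finset V} (hs : s ∈ K) (p : Realization K)
    (hp : p.weight.support ⊆ s) : ∃ x, Realization.ofSimplex s hs x = p := by
  refine ⟨⟨fun v => p.weight v, fun v => p.nonneg v, ?_⟩, ?_⟩
  · have := p.sum_eq_one
    rw [Finsupp.sum_of_support_subset _ hp _ (by simp)] at this
    rw [← this, Finset.sum_coe_sort s (fun v => p.weight v)]
  · ext v
    by_cases hv : v ∈ s
    · exact Realization.ofSimplex_weight hs _ ⟨v, hv⟩
    · rw [Finsupp.notMem_support_iff.mp fun h => hv (hp h), Finsupp.notMem_support_iff.mp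
        fun h => hv (Realization.ofSimplex_support_subset hs _ h)]

theorem Realization.mem_of_subset {s t : Finset V} (hs : s ∈ K) (ht : t.Nonempty) (hts : t ⊆ s) :
    t ∈ K :=
  (K.isRelLowerSet_faces hs).2 hts ht

theorem Realization.continuous_iff {W : Type*} [TopologicalSpace W] {f : Realization K → W} :
    Continuous f ↔ ∀ s (hs : s ∈ K), Continuous fun x => f (Realization.ofSimplex s hs x) := by
  rw [continuous_iSup_dom]
  simp only [continuous_coinduced_dom, Subtype.forall]
  rfl

theorem Realization.isClosed_iff {T : Set (Realization K)} :
    IsClosed T ↔ ∀ s (hs : s ∈ K), IsClosed (Realization.ofSimplex s hs ⁻¹' T) := by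
  rw [isClosed_iSup_iff]
  simp only [isClosed_coinduced, Subtype.forall]

theorem Realization.continuous_ofSimplex {s : Finset V} (hs : s ∈ K) :
    Continuous (Realization.ofSimplex s hs) :=
  Realization.continuous_iff.mp continuous_id s hs

theorem Realization.continuous_weight (v : V) :
    Continuous fun p : Realization K => p.weight v := by
  refine Realization.continuous_iff.mpr fun s hs => ?_
  by_cases hv : v ∈ s
  · simp only [Realization.ofSimplex_weight hs _ ⟨v, hv⟩]
    exact (continuous_apply _).comp continuous_subtype_val
  · have : ∀ x, (Realization.ofSimplex s hs x).weight v = 0 := fun x =>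
      Finsupp.notMem_support_iff.mp fun h => hv (Realization.ofSimplex_support_subset hs x h)
    simp only [this]
    exact continuous_const

theorem Realization.exists_weight_ne_zero (p : Realization K) : ∃ v, p.weight v ≠ 0 := by
  by_contra! h
  have := p.sum_eq_one
  simp [Finsupp.sum, h] at this

/-- Two points of `|K|` with proportional weights are equal. -/
theorem Realization.eq_of_proportional {p q : Realization K} {r t : ℝ} (hr : r ≠ 0)
    (h : ∀ v, p.weight v * r = q.weight v * t) : p = q := by
  have key : (p.weight.sum fun _ c => c) * r = (q.weight.sum fun _ c => c) * t := by
    classical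
    rw [Finsupp.sum_of_support_subset p.weight
        (Finset.subset_union_left (s₂ := q.weight.support)) _ (by simp),
      Finsupp.sum_of_support_subset q.weight
        (Finset.subset_union_right (s₁ := p.weight.support)) _ (by simp),
      Finset.sum_mul, Finset.sum_mul]
    exact Finset.sum_congr rfl fun v _ => h v
  -- Both families of weights sum to `1`, so the two factors of proportionality agree.
  rw [p.sum_eq_one, q.sum_eq_one, one_mul, one_mul] at key
  ext v
  exact mul_right_cancel₀ hr (by rw [h v, key])

/-- Nonnegative weights on a simplex can be scaled so that their sum is `1`. -/
theorem Realization.exists_scale (w : V →₀ ℝ) (hw : ∀ v, 0 ≤ w v) (hK : w.support ∈ K) :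
    ∃ (p : Realization K) (c : ℝ), 0 < c ∧ ∀ v, p.weight v = c * w v := by
  have hpos : 0 < w.sum fun _ r => r := by
    refine Finset.sum_pos (fun v hv => lt_of_le_of_ne (hw v) ?_) (K.isRelLowerSet_faces hK).1
    exact (Finsupp.mem_support_iff.mp hv).symm
  refine ⟨⟨(w.sum fun _ r => r)⁻¹ • w, fun v => ?_, ?_, ?_⟩, (w.sum fun _ r => r)⁻¹,
    inv_pos.mpr hpos, fun v => by simp⟩
  · simpa using mul_nonneg (inv_nonneg.mpr hpos.le) (hw v)
  · rw [Finsupp.sum_smul_index (by simp), ← Finsupp.mul_sum]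
    exact inv_mul_cancel₀ hpos.ne'
  · rwa [Finsupp.support_smul_eq (inv_ne_zero hpos.ne')]

/-- A compact subset of `|K| / |L|` is covered by finitely many closed simplices. -/
theorem Realization.exists_finite_cover (hL : ∃ s ∈ K, s ∈ L)
    {C : Set (Collapse (Realization.sub (K := K) L))} (hC : IsCompact C) :
    ∃ S : Set {s // s ∈ K}, S.Finite ∧ ∀ z ∈ C, ∃ s ∈ S, ∃ x,
      Collapse.mk (Realization.sub (K := K) L) (Realization.ofSimplex s.1 s.2 x) = z := by
  set m := Collapse.mk (Realization.sub (K := K) L) with hm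
  -- `S` consists of the simplices outside `L` whose interior meets `C`. Choosing one point of `C`
  -- in each gives a set all of whose subsets are closed; being closed and discrete in a compact
  -- set, it is finite.
  set S : Set {s // s ∈ K} :=
    {s | s.1 ∉ L ∧ ∃ p : Realization K, p.weight.support = s.1 ∧ m p ∈ C} with hS
  have hfin : S.Finite := by
    choose p hp hpC using fun s : S => s.2.2
    have hpL : ∀ s : S, p s ∉ Realization.sub (K := K) L := fun s => by
      simpa only [Realization.sub, Set.mem_ofPred_eq, hp s] using s.2.1
    have hinj : Function.Injective fun s => m (p s) := by
      intro s t hst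
      have := Collapse.mk_inj (hpL s) hst
      exact Subtype.ext (Subtype.ext (by rw [← hp s, ← hp t, this]))
    have hclosed : ∀ S' : Set S, IsClosed ((fun s => m (p s)) '' S') := by
      intro S'
      rw [Collapse.isClosed_iff_of_pt_notMem]
      · refine Realization.isClosed_iff.mpr fun σ hσ => Set.Finite.isClosed ?_
        -- A closed simplex has finitely many faces, so it contains only finitely many of the chosen
        -- points.
        have h1 : Set.Finite {s : S | s.1.1 ⊆ σ} := by
          refine Set.Finite.of_finite_image (f := fun s : S => s.1.1)
            ((Finset.finite_toSet σ.powerset).subset ?_)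
            (fun s _ t _ h => Subtype.ext (Subtype.ext h))
          rintro _ ⟨s, hs, rfl⟩
          simpa using hs
        refine Set.Finite.of_finite_image (f := Realization.ofSimplex σ hσ) ((h1.image p).subset ?_)
          (Realization.ofSimplex_injective hσ).injOn
        rintro _ ⟨x, ⟨s, -, hs⟩, rfl⟩
        have h2 := Collapse.mk_inj (hpL s) hs
        refine ⟨s, ?_, h2⟩
        rw [Set.mem_ofPred_eq, ← hp s, h2]
        exact Realization.ofSimplex_support_subset hσ x
      · rintro ⟨s, -, hs⟩
        exact hpL s (Collapse.mk_eq_pt_iff.mp hs)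
    have hcomp : IsCompact (Set.range fun s => m (p s)) := by
      rw [← Set.image_univ]
      refine hC.of_isClosed_subset (hclosed _) ?_
      rintro _ ⟨s, -, rfl⟩
      exact hpC s
    have hdisc : DiscreteTopology (Set.range fun s => m (p s)) := by
      refine discreteTopology_iff_forall_isClosed.mpr fun T => ?_
      refine isClosed_induced_iff.mpr ⟨_, hclosed ((fun s => m (p s)) ⁻¹' (Subtype.val '' T)), ?_⟩
      ext z
      constructor
      · rintro ⟨s, ⟨y, hy, hys⟩, hs⟩
        obtain rfl : y = z := Subtype.ext (hys.trans hs)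
        exact hy
      · intro hz
        obtain ⟨s, hs⟩ := z.2
        exact ⟨s, ⟨z, hz, hs.symm⟩, hs⟩
    have := hcomp.finite ⟨hdisc⟩
    exact Set.finite_coe_iff.mp ((Set.finite_range_iff hinj).mp this)
  -- The additional simplex `s₀` of `L` covers the base point, which may belong to `C`.
  obtain ⟨s₀, hs₀, hs₀L⟩ := hL
  refine ⟨insert ⟨s₀, hs₀⟩ S, hfin.insert _, fun z hz => ?_⟩
  rcases Collapse.eq_pt_or_exists z with rfl | ⟨p, hp, rfl⟩
  · obtain ⟨v, hv⟩ := (K.isRelLowerSet_faces hs₀).1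
    classical
    refine ⟨_, Set.mem_insert _ _, ⟨_, single_mem_stdSimplex ℝ ⟨v, hv⟩⟩, Collapse.mk_eq_pt ?_⟩
    exact Realization.mem_of_subset hs₀L ((K.isRelLowerSet_faces
      (Realization.support_mem _)).1) (Realization.ofSimplex_support_subset hs₀ _)
  · obtain ⟨x, hx⟩ := Realization.exists_ofSimplex_eq p.support_mem p subset_rfl
    exact ⟨⟨_, p.support_mem⟩, Set.mem_insert_of_mem _ ⟨hp, p, rfl, hz⟩, x, by rw [hx]⟩

/-- If `L` consists of the simplices that do not contain both vertices `x` and `y`, then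
`|K| / |L|` is a Hausdorff space. -/
theorem Realization.t2Space_collapse {x y : V} (h : ∀ s ∈ K, s ∈ L ↔ ¬ (x ∈ s ∧ y ∈ s)) :
    T2Space (Collapse (Realization.sub (K := K) L)) := by
  have h0 : ∀ p : Realization K,
      p ∈ Realization.sub (K := K) L ↔ p.weight x * p.weight y = 0 := fun p => by
    simp only [Realization.sub, Set.mem_ofPred_eq, h _ p.support_mem, Finsupp.mem_support_iff,
      mul_eq_zero]
    tauto
  -- The product of the weights at `x` and `y` vanishes exactly on `|L|`. Multiplying all weights by
  -- it gives a map that is constant on `|L|`, while a point off `|L|` is recovered by division.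
  -- Thus the quotient injects continuously into a Hausdorff space.
  let f : Realization K → ℝ × (V → ℝ) := fun p =>
    (p.weight x * p.weight y, fun v => p.weight v * (p.weight x * p.weight y))
  have hf : Continuous f := by
    have := Realization.continuous_weight (K := K)
    fun_prop
  have hf0 : ∀ p ∈ Realization.sub (K := K) L, f p = 0 := fun p hp => by
    simp only [f, (h0 p).mp hp, mul_zero]
    rfl
  refine T2Space.of_injective_continuous (f := Collapse.lift f 0 hf0) ?_
    (Collapse.continuous_lift hf _ _)
  have hpt : ∀ p ∉ Realization.sub (K := K) L, f p ≠ 0 := fun p hp hfp =>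
    hp ((h0 p).mpr (congrArg Prod.fst hfp))
  intro z z' hz
  rcases Collapse.eq_pt_or_exists z with rfl | ⟨p, hp, rfl⟩ <;>
  rcases Collapse.eq_pt_or_exists z' with rfl | ⟨p', hp', rfl⟩
  · rfl
  · exact absurd hz.symm (hpt p' hp')
  · exact absurd hz (hpt p hp)
  · simp only [Collapse.lift_mk, f, Prod.mk.injEq] at hz
    congr 1
    ext v
    have := congrFun hz.2 v
    rw [← hz.1] at this
    exact mul_right_cancel₀ (fun h => hp ((h0 p).mpr h)) this

/-- A function on a product of quotients `|Kᵢ| / |Lᵢ|`, with the compactly generated topology, is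
continuous if it is continuous on the products of closed simplices. -/
theorem continuous_of_continuous_prod_simplices {ι : Type*} [Finite ι] {V : ι → Type u}
    {K L : ∀ i, PreAbstractSimplicialComplex (V i)} (hL : ∀ i, ∃ s ∈ K i, s ∈ L i)
    [∀ i, T2Space (Collapse (Realization.sub (K := K i) (L i)))] {W : Type*} [TopologicalSpace W]
    {g : (∀ i, Collapse (Realization.sub (K := K i) (L i))) → W}
    (hg : ∀ s : ∀ i, {s // s ∈ K i}, Continuous fun x : ∀ i, stdSimplex ℝ (s i).1 =>
      g fun i => Collapse.mk _ (Realization.ofSimplex (s i).1 (s i).2 (x i))) :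
    Continuous (g ∘ (CompactCoherentification.mk _).symm) := by
  refine CompactCoherentification.continuous_dom_iff.mpr fun C hC => ?_
  refine continuousOn_iff_isClosed.mpr fun T hT => ?_
  choose S hS hcov using fun i =>
    Realization.exists_finite_cover (hL i) (hC.image (continuous_apply i))
  let m (s : ∀ i, {s // s ∈ K i}) (x : ∀ i, stdSimplex ℝ (s i).1) :
      ∀ i, Collapse (Realization.sub (K := K i) (L i)) :=
    fun i => Collapse.mk _ (Realization.ofSimplex (s i).1 (s i).2 (x i))
  have hm : ∀ s, Continuous (m s) := fun s => continuous_pi fun i =>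
    (Collapse.continuous_mk _).comp
      ((Realization.continuous_ofSimplex (s i).2).comp (continuous_apply i))
  -- The projections of `C` to the factors are compact, so finitely many products of closed
  -- simplices cover `C`. On `C`, the preimage of `T` is a finite union of compact sets, closed
  -- because the product is Hausdorff.
  refine ⟨⋃ s ∈ Set.univ.pi S, m s '' ((fun x => g (m s x)) ⁻¹' T), ?_, ?_⟩
  · refine (Set.Finite.pi hS).isClosed_biUnion
      fun s _ => IsCompact.isClosed ?_
    exact ((hT.preimage (hg s)).isCompact).image (hm s)
  · ext z
    simp only [Set.mem_inter_iff, Set.mem_iUnion, exists_prop, and_congr_left_iff]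
    intro hz
    constructor
    · intro hzT
      choose s hs x hx using fun i => hcov i (z i) ⟨z, hz, rfl⟩
      have hxz : m s x = z := funext hx
      refine ⟨s, fun i _ => hs i, x, ?_, hxz⟩
      rw [Set.mem_preimage, hxz]
      exact hzT
    · rintro ⟨s, -, x, hx, rfl⟩
      exact hx

end Realization

/-! ### Complexes glued in a row: the correspondence between points -/

section Glued

variable {V : Type u} {n : ℕ}

/-- The complex `K` is glued from the complexes `Kᵢ`, with vertices in `Iᵢ`, along the injections
`eᵢ`, the last vertex `βᵢ` of `Kᵢ` being identified with the first vertex `αᵢ₊₁` of `Kᵢ₊₁`: the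
simplices of `K` outside of `L` are the unions of simplices `sᵢ` of `Kᵢ` that contain `αᵢ`
and `βᵢ`. -/
structure IsGlued (K L : PreAbstractSimplicialComplex V)
    (K' L' : Fin n → PreAbstractSimplicialComplex V) (I : Fin n → Set V) (e : Fin n → V → V)
    (α β : Fin n → V) : Prop where
  pos : 0 < n
  injective : ∀ i, Function.Injective (e i)
  left_mem : ∀ i, α i ∈ I i
  right_mem : ∀ i, β i ∈ I i
  subset : ∀ i, ∀ s ∈ K' i, ∀ x ∈ s, x ∈ I i
  join : ∀ i k : Fin n, k.val = i.val + 1 → e i (β i) = e k (α k)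
  overlap : ∀ i k, i < k → ∀ x ∈ I i, ∀ y ∈ I k, e i x = e k y →
    k.val = i.val + 1 ∧ x = β i ∧ y = α k
  mem_short_piece : ∀ i, ∀ s ∈ K' i, s ∈ L' i ↔ ¬ (α i ∈ s ∧ β i ∈ s)
  exists_short_piece : ∀ i, ∃ s ∈ K' i, s ∈ L' i
  mem_short : ∀ s ∈ K, s ∈ L ↔ ¬ ∀ i, e i (α i) ∈ s ∧ e i (β i) ∈ s
  piece : ∀ s ∈ K, s ∉ L → ∀ i, ∀ t : Finset V, (∀ x, x ∈ t ↔ x ∈ I i ∧ e i x ∈ s) → t ∈ K' i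
  covered : ∀ s ∈ K, s ∉ L → ∀ v ∈ s, ∃ i, ∃ x ∈ I i, e i x = v
  glue : ∀ s : Fin n → Finset V, (∀ i, s i ∈ K' i ∧ s i ∉ L' i) → ∀ t : Finset V,
    (∀ v, v ∈ t ↔ ∃ i, ∃ x ∈ s i, e i x = v) → t ∈ K

namespace IsGlued

variable {K L : PreAbstractSimplicialComplex V} {K' L' : Fin n → PreAbstractSimplicialComplex V}
  {I : Fin n → Set V} {e : Fin n → V → V} {α β : Fin n → V}

/-- The correspondence between points of `|K|` and families of points of `|Kᵢ|`: the weights of the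
latter are proportional to those of the former. -/
def Rel (I : Fin n → Set V) (e : Fin n → V → V) (p : Realization K)
    (q : ∀ i, Realization (K' i)) : Prop :=
  ∀ i, ∀ x ∈ I i, ∀ y ∈ I i,
    (q i).weight x * p.weight (e i y) = (q i).weight y * p.weight (e i x)

/-- Proportionality is expressed by cross multiplication, so the condition is closed even where
weights vanish. -/
theorem isClosed_rel :
    IsClosed {z : Realization K × (∀ i, Realization (K' i)) | Rel I e z.1 z.2} := by
  simp only [Rel, Set.ofPred_forall]
  refine isClosed_iInter fun i => isClosed_iInter fun x => isClosed_iInter fun _ =>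
    isClosed_iInter fun y => isClosed_iInter fun _ => isClosed_eq ?_ ?_ <;>
  exact ((Realization.continuous_weight _).comp ((continuous_apply i).comp continuous_snd)).mul
    ((Realization.continuous_weight _).comp continuous_fst)

variable (h : IsGlued K L K' L' I e α β)

include h

theorem mem_sub {p : Realization K} : p ∈ Realization.sub (K := K) L ↔
    ∃ i, p.weight (e i (α i)) = 0 ∨ p.weight (e i (β i)) = 0 := by
  simp only [Realization.sub, Set.mem_ofPred_eq, h.mem_short _ p.support_mem,
    Finsupp.mem_support_iff]
  push Not
  refine exists_congr fun i => ?_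
  tauto

theorem mem_sub_piece {i : Fin n} {q : Realization (K' i)} :
    q ∈ Realization.sub (K := K' i) (L' i) ↔ q.weight (α i) = 0 ∨ q.weight (β i) = 0 := by
  simp only [Realization.sub, Set.mem_ofPred_eq, h.mem_short_piece _ _ q.support_mem,
    Finsupp.mem_support_iff]
  tauto

theorem weight_eq_zero {i : Fin n} (q : Realization (K' i)) {x : V} (hx : x ∉ I i) :
    q.weight x = 0 :=
  Finsupp.notMem_support_iff.mp fun hs => hx (h.subset i _ q.support_mem x hs)

/-- Off `|L|`, `p` is nonzero at both ends of each piece. If `q i` vanished at an end, cross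
multiplication with that end would make all weights of `q i` vanish. -/
theorem piece_notMem {p : Realization K} {q : ∀ i, Realization (K' i)} (hpq : Rel I e p q)
    (hp : p ∉ Realization.sub (K := K) L) (i : Fin n) :
    q i ∉ Realization.sub (K := K' i) (L' i) := by
  simp only [h.mem_sub, not_exists, not_or] at hp
  obtain ⟨x, hx⟩ := (q i).exists_weight_ne_zero
  have hxI : x ∈ I i := by_contra fun hxI => hx (h.weight_eq_zero _ hxI)
  rw [h.mem_sub_piece]
  rintro (h0 | h0)
  · have := hpq i x hxI _ (h.left_mem i)
    rw [h0, zero_mul] at this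
    exact mul_ne_zero hx (hp i).1 this
  · have := hpq i x hxI _ (h.right_mem i)
    rw [h0, zero_mul] at this
    exact mul_ne_zero hx (hp i).2 this

/-- Since each `q i` is nonzero at both ends, nonvanishing of `p` passes from one end of a piece to
the other by proportionality, and to the neighbouring pieces through the shared vertices. It starts
at some vertex of the support of `p`, which lies in a piece by `hp`. -/
theorem glued_notMem {p : Realization K} {q : ∀ i, Realization (K' i)} (hpq : Rel I e p q)
    (hp : ∀ v, p.weight v ≠ 0 → ∃ i, ∃ x ∈ I i, e i x = v)
    (hq : ∀ i, q i ∉ Realization.sub (K := K' i) (L' i)) :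
    p ∉ Realization.sub (K := K) L := by
  simp only [h.mem_sub_piece, not_or] at hq
  have hαβ : ∀ i, p.weight (e i (β i)) ≠ 0 ↔ p.weight (e i (α i)) ≠ 0 := fun i => by
    have := hpq i _ (h.left_mem i) _ (h.right_mem i)
    constructor <;> intro h0 h1
    · rw [h1, mul_zero] at this
      exact mul_ne_zero (hq i).1 h0 this
    · rw [h1, mul_zero] at this
      exact mul_ne_zero (hq i).2 h0 this.symm
  have hall : ∀ k (hk : k < n), p.weight (e ⟨k, hk⟩ (α ⟨k, hk⟩)) ≠ 0 ↔
      p.weight (e ⟨0, h.pos⟩ (α ⟨0, h.pos⟩)) ≠ 0 := by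
    intro k
    induction k with
    | zero => intro hk; rfl
    | succ k ih =>
      intro hk
      rw [← ih (by omega), ← hαβ ⟨k, by omega⟩, h.join ⟨k, by omega⟩ ⟨k + 1, hk⟩ rfl]
  obtain ⟨v, hv⟩ := p.exists_weight_ne_zero
  obtain ⟨i, x, hx, rfl⟩ := hp v hv
  have hi : p.weight (e i (α i)) ≠ 0 := by
    intro h0
    have := hpq i _ (h.left_mem i) x hx
    rw [h0, mul_zero] at this
    exact mul_ne_zero (hq i).1 hv this
  have h0 := (hall i.1 i.2).mp hi
  have h1 : ∀ j, p.weight (e j (α j)) ≠ 0 := fun j => (hall j.1 j.2).mpr h0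
  rw [h.mem_sub]
  rintro ⟨j, hj | hj⟩
  · exact h1 j hj
  · exact (hαβ j).mpr (h1 j) hj

theorem pieces_unique {p : Realization K} {q q' : ∀ i, Realization (K' i)} (hpq : Rel I e p q)
    (hpq' : Rel I e p q') (hp : p ∉ Realization.sub (K := K) L) : q = q' := by
  funext i
  have hq' := h.piece_notMem hpq' hp i
  simp only [h.mem_sub_piece, not_or] at hq'
  simp only [h.mem_sub, not_exists, not_or] at hp
  refine Realization.eq_of_proportional (t := (q i).weight (α i)) hq'.1 fun x => ?_
  by_cases hx : x ∈ I i
  · have h1 := hpq i x hx _ (h.left_mem i)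
    have h2 := hpq' i x hx _ (h.left_mem i)
    refine mul_right_cancel₀ (hp i).1 ?_
    linear_combination (q' i).weight (α i) * h1 - (q i).weight (α i) * h2
  · rw [h.weight_eq_zero _ hx, h.weight_eq_zero _ hx, zero_mul, zero_mul]

/-- The ratio of `p` to `p'` at the first vertex `v` is carried through each piece by `hstep` and on
to the next piece by the shared vertex, so it is the same everywhere. -/
theorem glued_unique {p p' : Realization K} {q : ∀ i, Realization (K' i)} (hpq : Rel I e p q)
    (hpq' : Rel I e p' q) (hp : p ∉ Realization.sub (K := K) L)
    (hp' : p' ∉ Realization.sub (K := K) L) : p = p' := by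
  have hq := h.piece_notMem hpq hp
  have hcov : ∀ p : Realization K, p ∉ Realization.sub (K := K) L →
      ∀ v, (¬ ∃ i, ∃ x ∈ I i, e i x = v) → p.weight v = 0 := fun p hp v hv =>
    Finsupp.notMem_support_iff.mp fun hs => hv (h.covered _ p.support_mem hp v hs)
  have hcov1 := hcov p hp
  have hcov2 := hcov p' hp'
  simp only [h.mem_sub_piece, not_or] at hq
  simp only [h.mem_sub, not_exists, not_or] at hp hp'
  set v := e ⟨0, h.pos⟩ (α ⟨0, h.pos⟩) with hv
  have hstep : ∀ i, ∀ x ∈ I i, p.weight (e i (α i)) * p'.weight v =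
      p'.weight (e i (α i)) * p.weight v →
      p.weight (e i x) * p'.weight v = p'.weight (e i x) * p.weight v := fun i x hx hi => by
    have h1 := hpq i x hx _ (h.left_mem i)
    have h2 := hpq' i x hx _ (h.left_mem i)
    refine mul_left_cancel₀ (hq i).1 ?_
    linear_combination p.weight v * h2 - p'.weight v * h1 + (q i).weight x * hi
  have hall : ∀ k (hk : k < n), p.weight (e ⟨k, hk⟩ (α ⟨k, hk⟩)) * p'.weight v =
      p'.weight (e ⟨k, hk⟩ (α ⟨k, hk⟩)) * p.weight v := by
    intro k
    induction k with
    | zero => intro hk; rw [hv]; ring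
    | succ k ih =>
      intro hk
      rw [← h.join ⟨k, by omega⟩ ⟨k + 1, hk⟩ rfl]
      exact hstep _ _ (h.right_mem _) (ih (by omega))
  refine Realization.eq_of_proportional (t := p.weight v) (hp' ⟨0, h.pos⟩).1 fun w => ?_
  by_cases hw : ∃ i, ∃ x ∈ I i, e i x = w
  · obtain ⟨i, x, hx, rfl⟩ := hw
    exact hstep i x hx (hall i.1 i.2)
  · rw [hcov1 w hw, hcov2 w hw, zero_mul, zero_mul]

/-- Restrict the weights of `p` to each piece and normalize. The control of the supports keeps each
`q i` in a fixed closed simplex when `p` varies in one, as the proof of continuity requires. -/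
theorem exists_pieces {p : Realization K} (hp : p ∉ Realization.sub (K := K) L) :
    ∃ q : ∀ i, Realization (K' i), Rel I e p q ∧
      ∀ i x, (q i).weight x ≠ 0 → p.weight (e i x) ≠ 0 := by
  classical
  let w (i : Fin n) : V →₀ ℝ :=
    (p.weight.comapDomain (e i) ((h.injective i).injOn)).filter (· ∈ I i)
  have hw : ∀ i, ∀ x ∈ I i, w i x = p.weight (e i x) := fun i x hx => by
    simp [w, hx]
  have hw0 : ∀ i, ∀ x ∉ I i, w i x = 0 := fun i x hx => by
    simp [w, hx]
  choose q c hc hq using fun i => Realization.exists_scale (K := K' i) (w i)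
    (fun x => by
      by_cases hx : x ∈ I i
      · rw [hw i x hx]; exact p.nonneg _
      · rw [hw0 i x hx])
    (h.piece _ p.support_mem hp i _ fun x => by
      by_cases hx : x ∈ I i
      · simp [hw i x hx, hx]
      · simp [hw0 i x hx, hx])
  refine ⟨q, fun i x hx y hy => ?_, fun i x hx => ?_⟩
  · rw [hq, hq, hw i x hx, hw i y hy]
    ring
  · have hxI : x ∈ I i := by_contra fun hxI => hx (h.weight_eq_zero _ hxI)
    rw [hq, hw i x hxI] at hx
    exact right_ne_zero_of_mul hx

theorem exists_glued {q : ∀ i, Realization (K' i)}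
    (hq : ∀ i, q i ∉ Realization.sub (K := K' i) (L' i)) :
    ∃ p : Realization K, Rel I e p q ∧ p ∉ Realization.sub (K := K) L ∧
      ∀ v, p.weight v ≠ 0 → ∃ i x, (q i).weight x ≠ 0 ∧ e i x = v := by
  classical
  -- These factors solve `cᵢ qᵢ(βᵢ) = cᵢ₊₁ qᵢ₊₁(αᵢ₊₁)` without division, so the rescaled pieces
  -- agree at the shared vertices.
  let c (i : Fin n) : ℝ :=
    (∏ j ∈ Finset.Iio i, (q j).weight (β j)) * ∏ j ∈ Finset.Ioi i, (q j).weight (α j)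
  have hq' := hq
  simp only [h.mem_sub_piece, not_or] at hq'
  have hcpos : ∀ i, 0 < c i := fun i => mul_pos
    (Finset.prod_pos fun j _ => lt_of_le_of_ne ((q j).nonneg _) (Ne.symm (hq' j).2))
    (Finset.prod_pos fun j _ => lt_of_le_of_ne ((q j).nonneg _) (Ne.symm (hq' j).1))
  have hc : ∀ i k : Fin n, k.val = i.val + 1 →
      c i * (q i).weight (β i) = c k * (q k).weight (α k) := fun i k hik => by
    have h1 : Finset.Iio k = insert i (Finset.Iio i) := by
      ext j; simp only [Finset.mem_Iio, Finset.mem_insert, Fin.lt_def, Fin.ext_iff]; omega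
    have h2 : Finset.Ioi i = insert k (Finset.Ioi k) := by
      ext j; simp only [Finset.mem_Ioi, Finset.mem_insert, Fin.lt_def, Fin.ext_iff]; omega
    simp only [c]
    rw [h1, h2, Finset.prod_insert (by simp), Finset.prod_insert (by simp)]
    ring
  have hlt : ∀ i k, i < k → ∀ x ∈ I i, ∀ y ∈ I k, e i x = e k y →
      c i * (q i).weight x = c k * (q k).weight y := fun i k hik x hx y hy hxy => by
    obtain ⟨h1, rfl, rfl⟩ := h.overlap i k hik x hx y hy hxy
    exact hc i k h1
  have hcons : ∀ i k, ∀ x ∈ I i, ∀ y ∈ I k, e i x = e k y →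
      c i * (q i).weight x = c k * (q k).weight y := fun i k x hx y hy hxy => by
    rcases lt_trichotomy i k with hik | rfl | hik
    · exact hlt i k hik x hx y hy hxy
    · rw [h.injective i hxy]
    · exact (hlt k i hik y hy x hx hxy.symm).symm
  -- By `hcons`, the value does not depend on the chosen piece and preimage of `v`.
  let f (v : V) : ℝ := if hv : ∃ i x, x ∈ I i ∧ e i x = v then
    c hv.choose * (q hv.choose).weight hv.choose_spec.choose else 0
  have hf : ∀ i, ∀ x ∈ I i, f (e i x) = c i * (q i).weight x := fun i x hx => by
    have hv : ∃ k y, y ∈ I k ∧ e k y = e i x := ⟨i, x, hx, rfl⟩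
    simp only [f, dif_pos hv]
    exact hcons _ _ _ hv.choose_spec.choose_spec.1 _ hx hv.choose_spec.choose_spec.2
  have hf0 : ∀ v, f v ≠ 0 → ∃ i x, (q i).weight x ≠ 0 ∧ e i x = v := fun v hfv => by
    by_cases hv : ∃ i x, x ∈ I i ∧ e i x = v
    · obtain ⟨i, x, hx, rfl⟩ := hv
      rw [hf i x hx] at hfv
      exact ⟨i, x, right_ne_zero_of_mul hfv, rfl⟩
    · simp only [f, dif_neg hv, ne_eq, not_true_eq_false] at hfv
  have hmem : ∀ i x, (q i).weight x ≠ 0 → x ∈ I i := fun i x hx =>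
    by_contra fun hxI => hx (h.weight_eq_zero _ hxI)
  let w : V →₀ ℝ := Finsupp.onFinset
    (Finset.univ.biUnion fun i => (q i).weight.support.image (e i)) f fun v hv => by
      obtain ⟨i, x, hx, hxv⟩ := hf0 v hv
      simp only [Finset.mem_biUnion, Finset.mem_univ, true_and, Finset.mem_image,
        Finsupp.mem_support_iff]
      exact ⟨i, x, hx, hxv⟩
  obtain ⟨p, r, hr, hp⟩ := Realization.exists_scale (K := K) w
    (fun v => by
      by_cases hv : f v = 0
      · exact hv.ge
      · obtain ⟨i, x, hx, rfl⟩ := hf0 v hv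
        change 0 ≤ f (e i x)
        rw [hf i x (hmem i x hx)]
        exact mul_nonneg (hcpos i).le ((q i).nonneg x))
    (h.glue (fun i => (q i).weight.support) (fun i => ⟨(q i).support_mem, hq i⟩) _ fun v => by
      simp only [Finsupp.mem_support_iff]
      constructor
      · intro hv
        obtain ⟨i, x, hx, hxv⟩ := hf0 v hv
        exact ⟨i, x, hx, hxv⟩
      · rintro ⟨i, x, hx, rfl⟩
        change f (e i x) ≠ 0
        rw [hf i x (hmem i x hx)]
        exact mul_ne_zero (hcpos i).ne' hx)
  have hp' : ∀ v, p.weight v = r * f v := hp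
  have hsupp : ∀ v, p.weight v ≠ 0 → ∃ i x, (q i).weight x ≠ 0 ∧ e i x = v := fun v hv =>
    hf0 v (right_ne_zero_of_mul (hp' v ▸ hv))
  have hrel : Rel I e p q := fun i x hx y hy => by
    rw [hp', hp', hf i x hx, hf i y hy]
    ring
  refine ⟨p, hrel, h.glued_notMem hrel (fun v hv => ?_) hq, hsupp⟩
  obtain ⟨i, x, hx, hxv⟩ := hsupp v hv
  exact ⟨i, x, hmem i x hx, hxv⟩

end IsGlued

end Glued

/-! ### The homeomorphism of a glued quotient with the smash product -/

section GluedHomeomorphism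

variable {V : Type u} {n : ℕ}

namespace IsGlued

variable {K L : PreAbstractSimplicialComplex V} {K' L' : Fin n → PreAbstractSimplicialComplex V}
  {I : Fin n → Set V} {e : Fin n → V → V} {α β : Fin n → V}

/-- The base points of the quotients `|Kᵢ| / |Lᵢ|`. -/
abbrev piecePt (K' L' : Fin n → PreAbstractSimplicialComplex V) (i : Fin n) :
    Collapse (Realization.sub (K := K' i) (L' i)) :=
  Collapse.pt _

/-- The point of the smash product given by a family of points of `|Kᵢ|`. -/
def smashMk (L' : Fin n → PreAbstractSimplicialComplex V) (q : ∀ i, Realization (K' i)) :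
    Smash (piecePt K' L') :=
  Collapse.mk _ (CompactCoherentification.mk _ fun i => Collapse.mk _ (q i))

theorem smashMk_eq_pt {q : ∀ i, Realization (K' i)}
    (hq : ∃ i, q i ∈ Realization.sub (K := K' i) (L' i)) : smashMk L' q = Smash.pt _ := by
  obtain ⟨i, hi⟩ := hq
  exact Collapse.mk_eq_pt ⟨i, Collapse.mk_eq_pt hi⟩

open Classical in
/-- The map from `|K|` to the smash product of the quotients `|Kᵢ| / |Lᵢ|`. -/
def toSmash (K L : PreAbstractSimplicialComplex V)
    (K' L' : Fin n → PreAbstractSimplicialComplex V) (I : Fin n → Set V) (e : Fin n → V → V)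
    (p : Realization K) : Smash (piecePt K' L') :=
  if hp : p ∉ Realization.sub (K := K) L ∧ ∃ q : ∀ i, Realization (K' i), Rel I e p q then
    smashMk L' hp.2.choose else Smash.pt _

open Classical in
/-- The map from the product of the quotients `|Kᵢ| / |Lᵢ|` to `|K| / |L|`. -/
def ofProd (K L : PreAbstractSimplicialComplex V)
    (K' L' : Fin n → PreAbstractSimplicialComplex V) (I : Fin n → Set V) (e : Fin n → V → V)
    (z : ∀ i, Collapse (Realization.sub (K := K' i) (L' i))) :
    Collapse (Realization.sub (K := K) L) :=
  if hz : ∃ p : Realization K, p ∉ Realization.sub (K := K) L ∧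
      ∃ q : ∀ i, Realization (K' i), Rel I e p q ∧ ∀ i, Collapse.mk _ (q i) = z i then
    Collapse.mk _ hz.choose else Collapse.pt _

theorem toSmash_of_mem {p : Realization K} (hp : p ∈ Realization.sub (K := K) L) :
    toSmash K L K' L' I e p = Smash.pt _ :=
  dif_neg fun h => h.1 hp

variable (h : IsGlued K L K' L' I e α β)

include h

theorem toSmash_of_rel {p : Realization K} {q : ∀ i, Realization (K' i)} (hpq : Rel I e p q)
    (hp : p ∉ Realization.sub (K := K) L) : toSmash K L K' L' I e p = smashMk L' q := by
  have hp' : p ∉ Realization.sub (K := K) L ∧ ∃ q : ∀ i, Realization (K' i), Rel I e p q :=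
    ⟨hp, q, hpq⟩
  rw [toSmash, dif_pos hp', h.pieces_unique hp'.2.choose_spec hpq hp]

theorem ofProd_of_rel {p : Realization K} {q : ∀ i, Realization (K' i)} (hpq : Rel I e p q)
    (hp : p ∉ Realization.sub (K := K) L) :
    ofProd K L K' L' I e (fun i => Collapse.mk _ (q i)) = Collapse.mk _ p := by
  have hz : ∃ p : Realization K, p ∉ Realization.sub (K := K) L ∧
      ∃ q' : ∀ i, Realization (K' i), Rel I e p q' ∧
        ∀ i, Collapse.mk (Realization.sub (K := K' i) (L' i)) (q' i) = Collapse.mk _ (q i) :=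
    ⟨p, hp, q, hpq, fun i => rfl⟩
  obtain ⟨h1, q', h2, h3⟩ := hz.choose_spec
  have hq : q' = q := funext fun i => Collapse.mk_inj (h.piece_notMem h2 h1 i) (h3 i)
  rw [ofProd, dif_pos hz, h.glued_unique (hq ▸ h2) hpq h1 hp]

theorem ofProd_of_eq_pt {z : ∀ i, Collapse (Realization.sub (K := K' i) (L' i))}
    (hz : ∃ i, z i = Collapse.pt _) : ofProd K L K' L' I e z = Collapse.pt _ := by
  refine dif_neg ?_
  rintro ⟨p, hp, q, hpq, hq⟩
  obtain ⟨i, hi⟩ := hz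
  exact h.piece_notMem hpq hp i (Collapse.mk_eq_pt_iff.mp ((hq i).trans hi))

/-- On a closed simplex `s` outside `L`, the corresponding families range over the compact product
of the simplices `t i` cut out of `s` by the pieces, so the closed correspondence `Rel` applies. The
exceptional closed set is the part of `s` in `|L|`. -/
theorem continuous_toSmash : Continuous (toSmash K L K' L' I e) := by
  classical
  refine Realization.continuous_iff.mpr fun s hs => ?_
  by_cases hsL : s ∈ L
  · have : ∀ x, toSmash K L K' L' I e (Realization.ofSimplex s hs x) = Smash.pt _ := fun x =>
      toSmash_of_mem (Realization.mem_of_subset hsL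
        (K.isRelLowerSet_faces (Realization.support_mem _)).1
        (Realization.ofSimplex_support_subset hs x))
    simp only [this]
    exact continuous_const
  let t (i : Fin n) : Finset V := (s.preimage (e i) (h.injective i).injOn).filter (· ∈ I i)
  have ht : ∀ i, t i ∈ K' i := fun i => h.piece s hs hsL i _ fun x => by
    simp [t, and_comm]
  let m (b : ∀ i, stdSimplex ℝ (t i)) (i : Fin n) : Realization (K' i) :=
    Realization.ofSimplex (t i) (ht i) (b i)
  have hm : Continuous m := continuous_pi fun i =>
    (Realization.continuous_ofSimplex (ht i)).comp (continuous_apply i)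
  have hs' : Continuous (Realization.ofSimplex s hs) := Realization.continuous_ofSimplex hs
  refine continuous_of_closed_correspondence
    (R := {z | Rel I e (Realization.ofSimplex s hs z.1) (m z.2)}) (h := fun b => smashMk L' (m b))
    (Z := {x | ∃ i, (Realization.ofSimplex s hs x).weight (e i (α i)) = 0 ∨
      (Realization.ofSimplex s hs x).weight (e i (β i)) = 0}) (c := Smash.pt _) ?_ ?_ ?_ ?_ ?_ ?_
  · exact isClosed_rel.preimage (hs'.prodMap hm)
  · rw [Set.ofPred_exists]
    refine isClosed_iUnion_of_finite fun i => IsClosed.union ?_ ?_ <;>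
    exact isClosed_eq ((Realization.continuous_weight _).comp hs') continuous_const
  -- The source is a compact product of simplices, so continuity into the product topology suffices
  -- for the compactly generated one.
  · refine (Collapse.continuous_mk _).comp
      (CompactCoherentification.continuous_mk_comp_iff_of_compactSpace.mpr ?_)
    exact continuous_pi fun i => (Collapse.continuous_mk _).comp ((continuous_apply i).comp hm)
  · intro x hx
    exact toSmash_of_mem (h.mem_sub.mpr hx)
  · intro x hx
    obtain ⟨q, hq, hqx⟩ := h.exists_pieces (mt h.mem_sub.mp hx)
    choose b hb using fun i => Realization.exists_ofSimplex_eq (ht i) (q i) fun v hv => by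
      have hv0 := Finsupp.mem_support_iff.mp hv
      simp only [t, Finset.mem_filter, Finset.mem_preimage]
      exact ⟨Realization.ofSimplex_support_subset hs x (Finsupp.mem_support_iff.mpr (hqx i v hv0)),
        h.subset i _ (q i).support_mem v hv⟩
    refine ⟨b, ?_⟩
    have hmb : m b = q := funext hb
    simpa only [Set.mem_ofPred_eq, hmb] using hq
  · intro x b hxb
    by_cases hx : Realization.ofSimplex s hs x ∈ Realization.sub (K := K) L
    -- `Rel` may also relate a point of `|L|` to a family. By `glued_notMem`, some member then lies
    -- in its `|L' i|`, so both sides are the base point.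
    · rw [toSmash_of_mem hx, smashMk_eq_pt]
      by_contra! hb
      refine h.glued_notMem hxb (fun v hv => ?_) hb hx
      exact h.covered s hs hsL v
        (Realization.ofSimplex_support_subset hs x (Finsupp.mem_support_iff.mpr hv))
    · exact h.toSmash_of_rel hxb hx

/-- The same argument in the other direction: the glued points of a product of closed simplices
outside the `L' i` lie in the single closed simplex `t` spanned by the images of their vertices. -/
theorem continuous_ofProd :
    Continuous (ofProd K L K' L' I e ∘ (CompactCoherentification.mk _).symm) := by
  classical
  have (i : Fin n) : T2Space (Collapse (Realization.sub (K := K' i) (L' i))) :=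
    Realization.t2Space_collapse (h.mem_short_piece i)
  refine continuous_of_continuous_prod_simplices h.exists_short_piece fun s => ?_
  by_cases hsL : ∃ i, (s i).1 ∈ L' i
  · obtain ⟨i, hi⟩ := hsL
    have : ∀ x : ∀ i, stdSimplex ℝ (s i).1, ofProd K L K' L' I e (fun i => Collapse.mk _
        (Realization.ofSimplex (s i).1 (s i).2 (x i))) = Collapse.pt _ := fun x =>
      h.ofProd_of_eq_pt ⟨i, Collapse.mk_eq_pt (Realization.mem_of_subset hi
        ((K' i).isRelLowerSet_faces (Realization.support_mem _)).1
        (Realization.ofSimplex_support_subset (s i).2 (x i)))⟩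
    simp only [this]
    exact continuous_const
  push Not at hsL
  let t : Finset V := Finset.univ.biUnion fun i => (s i).1.image (e i)
  have htv : ∀ v, v ∈ t ↔ ∃ i, ∃ x ∈ (s i).1, e i x = v := fun v => by simp [t]
  have ht : t ∈ K := h.glue (fun i => (s i).1) (fun i => ⟨(s i).2, hsL i⟩) t htv
  let m (b : ∀ i, stdSimplex ℝ (s i).1) (i : Fin n) : Realization (K' i) :=
    Realization.ofSimplex (s i).1 (s i).2 (b i)
  have hm : Continuous m := continuous_pi fun i =>
    (Realization.continuous_ofSimplex (s i).2).comp (continuous_apply i)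
  have ht' : Continuous (Realization.ofSimplex t ht) := Realization.continuous_ofSimplex ht
  refine continuous_of_closed_correspondence
    (R := {z | Rel I e (Realization.ofSimplex t ht z.2) (m z.1)})
    (h := fun x => Collapse.mk _ (Realization.ofSimplex t ht x))
    (Z := {b | ∃ i, (m b i).weight (α i) = 0 ∨ (m b i).weight (β i) = 0})
    (c := Collapse.pt _) ?_ ?_ ?_ ?_ ?_ ?_
  · exact isClosed_rel.preimage ((ht'.prodMap hm).comp continuous_swap)
  · rw [Set.ofPred_exists]
    refine isClosed_iUnion_of_finite fun i => IsClosed.union ?_ ?_ <;>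
    exact isClosed_eq ((Realization.continuous_weight _).comp ((continuous_apply i).comp hm))
      continuous_const
  · exact (Collapse.continuous_mk _).comp ht'
  · rintro b ⟨i, hi⟩
    exact h.ofProd_of_eq_pt ⟨i, Collapse.mk_eq_pt (h.mem_sub_piece.mpr hi)⟩
  · intro b hb
    obtain ⟨p, hp, -, hpb⟩ := h.exists_glued (q := m b) fun i hi =>
      hb ⟨i, h.mem_sub_piece.mp hi⟩
    obtain ⟨x, hx⟩ := Realization.exists_ofSimplex_eq ht p fun v hv => by
      obtain ⟨i, x, hx, hxv⟩ := hpb v (Finsupp.mem_support_iff.mp hv)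
      exact (htv v).mpr ⟨i, x, Realization.ofSimplex_support_subset (s i).2 (b i)
        (Finsupp.mem_support_iff.mpr hx), hxv⟩
    refine ⟨x, ?_⟩
    simpa only [Set.mem_ofPred_eq, hx] using hp
  · intro b x hxb
    by_cases hx : Realization.ofSimplex t ht x ∈ Realization.sub (K := K) L
    · rw [Collapse.mk_eq_pt hx]
      refine h.ofProd_of_eq_pt ?_
      by_contra! hb
      refine h.glued_notMem hxb (fun v hv => ?_) (fun i hi => hb i (Collapse.mk_eq_pt hi)) hx
      obtain ⟨i, x, hx, hxv⟩ := (htv v).mp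
        (Realization.ofSimplex_support_subset ht x (Finsupp.mem_support_iff.mpr hv))
      exact ⟨i, x, h.subset i _ (s i).2 x hx, hxv⟩
    · exact h.ofProd_of_rel hxb hx

/-- The quotient `|K| / |L|` is homeomorphic to the smash product of the quotients
`|Kᵢ| / |Lᵢ|`. -/
def homeomorphSmash : Collapse (Realization.sub (K := K) L) ≃ₜ Smash (piecePt K' L') where
  toFun := Collapse.lift (toSmash K L K' L' I e) (Smash.pt _) fun _ hp => toSmash_of_mem hp
  invFun := Collapse.lift (ofProd K L K' L' I e ∘ (CompactCoherentification.mk _).symm)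
    (Collapse.pt _) fun _ hz => h.ofProd_of_eq_pt hz
  left_inv z := by
    rcases Collapse.eq_pt_or_exists z with rfl | ⟨p, hp, rfl⟩
    · rfl
    · obtain ⟨q, hq, -⟩ := h.exists_pieces hp
      rw [Collapse.lift_mk, h.toSmash_of_rel hq hp]
      exact h.ofProd_of_rel hq hp
  right_inv z := by
    rcases Collapse.eq_pt_or_exists z with rfl | ⟨z, hz, rfl⟩
    · rfl
    · have hz' : ∀ i, ∃ q ∉ Realization.sub (K := K' i) (L' i), Collapse.mk _ q =
          (CompactCoherentification.mk _).symm z i := fun i =>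
        (Collapse.eq_pt_or_exists _).resolve_left fun hi => hz ⟨i, hi⟩
      choose q hq hqz using hz'
      obtain ⟨p, hp, hpL, -⟩ := h.exists_glued hq
      have hzq : z = CompactCoherentification.mk _ fun i => Collapse.mk _ (q i) :=
        (funext hqz).symm
      rw [hzq, Collapse.lift_mk, Function.comp_apply, Equiv.symm_apply_apply,
        h.ofProd_of_rel hp hpL, Collapse.lift_mk, h.toSmash_of_rel hp hpL]
      rfl
  continuous_toFun := Collapse.continuous_lift h.continuous_toSmash _ _
  continuous_invFun := Collapse.continuous_lift h.continuous_ofProd _ _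

end IsGlued

/-- A pointed homeomorphism is a homotopy equivalence of pointed spaces. -/
theorem PointedHomeomorphic.pointedHomotopyEquivalent {M : Type u} {N : Type v}
    [TopologicalSpace M] [TopologicalSpace N] {x : M} {y : N} (h : PointedHomeomorphic x y) :
    PointedHomotopyEquivalent x y := by
  obtain ⟨f, rfl⟩ := h
  refine ⟨f, f.symm, rfl, f.symm_apply_apply x, ?_, ?_⟩
  · rw [f.symm_comp_toContinuousMap]
    exact ContinuousMap.HomotopicRel.refl _
  · rw [f.toContinuousMap_comp_symm]
    exact ContinuousMap.HomotopicRel.refl _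

end GluedHomeomorphism

/-! ### Wedge decomposition along subcomplexes -/

section WedgeDecomposition

variable {V ι : Type u} {K L : PreAbstractSimplicialComplex V}
  {K' : ι → PreAbstractSimplicialComplex V}

/-- The inclusion of the realization of a subcomplex. -/
def Realization.inclusion {K₁ K₂ : PreAbstractSimplicialComplex V} (h : ∀ s ∈ K₁, s ∈ K₂)
    (p : Realization K₁) : Realization K₂ :=
  ⟨p.weight, p.nonneg, p.sum_eq_one, h _ p.support_mem⟩

theorem Realization.continuous_inclusion {K₁ K₂ : PreAbstractSimplicialComplex V}
    (h : ∀ s ∈ K₁, s ∈ K₂) : Continuous (Realization.inclusion h) :=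
  Realization.continuous_iff.mpr fun s hs => Realization.continuous_ofSimplex (h s hs)

theorem Realization.inclusion_mem_sub {K₁ K₂ : PreAbstractSimplicialComplex V}
    (h : ∀ s ∈ K₁, s ∈ K₂) {p : Realization K₁} :
    Realization.inclusion h p ∈ Realization.sub (K := K₂) L ↔ p ∈ Realization.sub (K := K₁) L :=
  Iff.rfl

open Classical in
/-- The map from `|K|` to the wedge of the quotients `|Kᵢ| / |L|` for subcomplexes `Kᵢ`. -/
def toWedge (K L : PreAbstractSimplicialComplex V) (K' : ι → PreAbstractSimplicialComplex V)
    (p : Realization K) :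
    Wedge fun i => Collapse.pt (Realization.sub (K := K' i) L) :=
  if hp : p.weight.support ∉ L ∧ ∃ i, p.weight.support ∈ K' i then
    Collapse.mk _ ⟨hp.2.choose, Collapse.mk _ ⟨p.weight, p.nonneg, p.sum_eq_one,
      hp.2.choose_spec⟩⟩
  else Wedge.pt _

/-- The map from the wedge of the quotients `|Kᵢ| / |L|` to `|K| / |L|` for subcomplexes `Kᵢ`. -/
def ofWedge (hK : ∀ i, ∀ s ∈ K' i, s ∈ K) :
    (Wedge fun i => Collapse.pt (Realization.sub (K := K' i) L)) →
      Collapse (Realization.sub (K := K) L) :=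
  Collapse.lift (fun z => Collapse.lift
      (fun p => Collapse.mk _ (Realization.inclusion (hK z.1) p)) (Collapse.pt _)
      (fun _ hp => Collapse.mk_eq_pt ((Realization.inclusion_mem_sub (hK z.1)).mpr hp)) z.2)
    (Collapse.pt _) fun z hz => by
    rw [show z.2 = Collapse.pt _ from hz]
    rfl

/-- A point supported on a face in `L` goes to the base point on both sides; for any other face the
chosen index can only be `i`. Hence one formula describes the map on the whole closed simplex, which
gives its continuity. -/
theorem toWedge_eq {s : Finset V} (hs : s ∈ K) {i : ι} (hsi : s ∈ K' i)
    (huniq : ∀ s ∉ L, ∀ i j, s ∈ K' i → s ∈ K' j → i = j) (x : stdSimplex ℝ s) :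
    toWedge K L K' (Realization.ofSimplex s hs x) =
      Collapse.mk _ ⟨i, Collapse.mk _ (Realization.ofSimplex s hsi x)⟩ := by
  have hsupp : (Realization.ofSimplex s hs x).weight.support ∈ K' i :=
    (Realization.ofSimplex s hsi x).support_mem
  by_cases hL : (Realization.ofSimplex s hs x).weight.support ∈ L
  · rw [toWedge, dif_neg fun h => h.1 hL]
    have hpt : Collapse.mk (Realization.sub (K := K' i) L) (Realization.ofSimplex s hsi x) =
        Collapse.pt _ := Collapse.mk_eq_pt hL
    exact (Collapse.mk_eq_pt (A := basePoints fun i => Collapse.pt (Realization.sub (K := K' i) L))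
      (y := ⟨i, Collapse.mk _ (Realization.ofSimplex s hsi x)⟩) hpt).symm
  · have hp : (Realization.ofSimplex s hs x).weight.support ∉ L ∧
      ∃ i, (Realization.ofSimplex s hs x).weight.support ∈ K' i := ⟨hL, i, hsupp⟩
    rw [toWedge, dif_pos hp]
    obtain rfl : hp.2.choose = i := huniq _ hL _ _ hp.2.choose_spec hsupp
    rfl

/-- If every simplex of `K` outside of `L` belongs to exactly one of the subcomplexes `Kᵢ`, then
`|K| / |L|` is the wedge of the quotients `|Kᵢ| / |L|`. -/
def homeomorphWedge (hK : ∀ i, ∀ s ∈ K' i, s ∈ K) (hex : ∀ s ∈ K, s ∉ L → ∃ i, s ∈ K' i)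
    (huniq : ∀ s ∉ L, ∀ i j, s ∈ K' i → s ∈ K' j → i = j) :
    Collapse (Realization.sub (K := K) L) ≃ₜ
      Wedge fun i => Collapse.pt (Realization.sub (K := K' i) L) where
  toFun := Collapse.lift (toWedge K L K') (Wedge.pt _) fun p hp => dif_neg fun h => h.1 hp
  invFun := ofWedge hK
  left_inv z := by
    rcases Collapse.eq_pt_or_exists z with rfl | ⟨p, hp, rfl⟩
    · rfl
    · change ofWedge hK (toWedge K L K' p) = _
      rw [toWedge, dif_pos ⟨hp, hex _ p.support_mem hp⟩]
      rfl
  right_inv z := by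
    rcases Collapse.eq_pt_or_exists z with rfl | ⟨⟨i, z⟩, hz, rfl⟩
    · rfl
    · rcases Collapse.eq_pt_or_exists z with rfl | ⟨p, hp, rfl⟩
      · exact absurd rfl hz
      · obtain ⟨x, hx⟩ := Realization.exists_ofSimplex_eq p.support_mem p subset_rfl
        have key : toWedge K L K' (Realization.inclusion (hK i)
            (Realization.ofSimplex _ p.support_mem x)) =
            Collapse.mk _ ⟨i, Collapse.mk _ (Realization.ofSimplex _ p.support_mem x)⟩ :=
          toWedge_eq (hK i _ p.support_mem) p.support_mem huniq x
        rw [hx] at key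
        exact key
  continuous_toFun := by
    refine Collapse.continuous_lift (Realization.continuous_iff.mpr fun s hs => ?_) _ _
    by_cases hsL : s ∈ L
    · have : ∀ x, toWedge K L K' (Realization.ofSimplex s hs x) = Wedge.pt _ := fun x =>
        dif_neg fun h => h.1 (Realization.mem_of_subset hsL
          (K.isRelLowerSet_faces (Realization.support_mem _)).1
          (Realization.ofSimplex_support_subset hs x))
      simp only [this]
      exact continuous_const
    · obtain ⟨i, hi⟩ := hex s hs hsL
      simp only [toWedge_eq hs hi huniq]
      exact (Collapse.continuous_mk _).comp (continuous_sigmaMk.comp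
        ((Collapse.continuous_mk _).comp (Realization.continuous_ofSimplex hi)))
  continuous_invFun :=
    Collapse.continuous_lift (continuous_sigma fun i => Collapse.continuous_lift
      (f := fun p => Collapse.mk _ (Realization.inclusion (hK i) p))
      ((Collapse.continuous_mk _).comp (Realization.continuous_inclusion (hK i))) _
      fun _ hp => Collapse.mk_eq_pt ((Realization.inclusion_mem_sub (hK i)).mpr hp)) _ _

end WedgeDecomposition

/-! ### Frames of sequences below `m_X` -/

section Paths

variable {X : Type u} [MetricSpace X]

theorem pathLength_append_cons : ∀ (l : List X) (x : X) (l' : List X),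
    pathLength (l ++ x :: l') = pathLength (l ++ [x]) + pathLength (x :: l')
  | [], x, l' => by simp [pathLength]
  | [y], x, l' => by simp [pathLength]
  | y :: z :: l, x, l' => by
      have := pathLength_append_cons (z :: l) x l'
      simp only [List.cons_append, pathLength] at this ⊢
      linarith

theorem pathLength_take_add_two : ∀ (l : List X) (j : ℕ) (h : j + 1 < l.length),
    pathLength (l.take (j + 2)) = pathLength (l.take (j + 1)) + dist l[j] l[j + 1]
  | [], j, h => by simp at h
  | [x], j, h => by simp at h
  | x :: y :: l, 0, h => by simp [pathLength]
  | x :: y :: l, j + 1, h => by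
      have := pathLength_take_add_two (y :: l) j (by simpa using h)
      simp only [List.take_succ_cons, pathLength, List.getElem_cons_succ] at this ⊢
      linarith

theorem singularTail_eq_self : ∀ (x : X) (l : List X),
    (∀ u v w : X, [u, v, w] <:+: x :: l → ¬ IsSmooth u v w) → singularTail (x :: l) = l
  | _, [], _ => rfl
  | _, [_], _ => rfl
  | x, y :: z :: l, h => by
      have hxyz : ¬ IsSmooth x y z := h x y z (List.prefix_append [x, y, z] l).isInfix
      have ih := singularTail_eq_self y (z :: l) fun u v w huvw => h u v w (huvw.trans
        (List.suffix_cons x _).isInfix)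
      rw [singularTail, if_neg hxyz, ih]

theorem IsSingularSequence.frame_eq {l : List X} (h : IsSingularSequence l) : frame l = l := by
  cases l with
  | nil => rfl
  | cons x l => rw [frame, singularTail_eq_self x l h.2]

/-- Below `m_X`, the frame of a sequence is a singular sequence of the same length. -/
theorem isSingularSequence_frame (l : List X) (hl : IsSequence l)
    (hm : ((pathLength l : ℝ) : EReal) < fourCutInf X) :
    IsSingularSequence (frame l) ∧ pathLength (frame l) = pathLength l := by
  induction hn : l.length using Nat.strong_induction_on generalizing l with | _ n IH =>
  by_cases hs : ∀ x y z : X, [x, y, z] <:+: l → ¬ IsSmooth x y z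
  · have h : IsSingularSequence l := ⟨hl, hs⟩
    rw [h.frame_eq]
    exact ⟨h, rfl⟩
  · push Not at hs
    -- Deleting one smooth point `y` preserves the length and, below `m_X`, the frame; then
    -- induction on the number of points applies.
    obtain ⟨x, y, z, ⟨u, v, rfl⟩, hxyz⟩ := hs
    have hchain := hl.2
    simp only [List.append_assoc, List.cons_append, List.nil_append] at hchain hm ⊢
    rw [List.isChain_split, List.isChain_cons_cons, List.isChain_cons_cons] at hchain
    have hxz : x ≠ z := by
      rintro rfl
      have h1 := dist_pos.mpr hchain.2.1
      have h2 := dist_nonneg (x := y) (y := x)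
      simp only [IsSmooth, dist_self] at hxyz
      linarith
    have hlen : pathLength (u ++ x :: z :: v) = pathLength (u ++ x :: y :: z :: v) := by
      rw [pathLength_append_cons u x (z :: v), pathLength_append_cons u x (y :: z :: v)]
      simp only [IsSmooth] at hxyz
      simp only [pathLength]
      linarith
    have hchain' : (u ++ x :: z :: v).IsChain (· ≠ ·) := by
      rw [List.isChain_split, List.isChain_cons_cons]
      exact ⟨hchain.1, hxz, hchain.2.2.2⟩
    have ih := IH _ (by simp [← hn]) (u ++ x :: z :: v) ⟨by simp, hchain'⟩ (hlen ▸ hm) rfl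
    have hfr : frame (u ++ x :: z :: v) = frame (u ++ x :: y :: z :: v) :=
      frame_eq_of_sublist (by simp) (by simpa using hl.2) hchain' (by simp) hlen hm
    rw [← hfr, ← hlen]
    exact ih

theorem head?_frame (l : List X) : (frame l).head? = l.head? := by
  cases l <;> rfl

theorem getLast?_singularTail : ∀ (x : X) (l : List X),
    (singularTail (x :: l)).getLast? = l.getLast?
  | _, [] => rfl
  | _, [_] => rfl
  | x, y :: z :: l => by
      have ih := getLast?_singularTail y (z :: l)
      rw [singularTail, List.getLast?_cons_cons]
      split_ifs
      · exact ih
      · rw [List.getLast?_cons, ih]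
        simp [List.getLast?_cons]

theorem getLast?_frame (l : List X) : (frame l).getLast? = l.getLast? := by
  cases l with
  | nil => rfl
  | cons x l => rw [frame, List.getLast?_cons, getLast?_singularTail, List.getLast?_cons]

end Paths

/-! ### Chains of maximal length in a causal interval -/

section Chains

variable {X : Type u} [MetricSpace X]

theorem Enumerates.unique {l l' : List (Spacetime X)} {s : Finset (Spacetime X)}
    (h : Enumerates l s) (h' : Enumerates l' s) : l = l' := by
  refine List.Perm.eq_of_pairwise (fun p q _ _ h1 h2 => absurd h1 h2.asymm) h.1 h'.1 ?_
  rw [List.perm_ext_iff_of_nodup (h.1.imp fun h => h.ne) (h'.1.imp fun h => h.ne)]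
  exact fun p => (h.2 p).trans (h'.2 p).symm

theorem Enumerates.sublist {l l' : List (Spacetime X)} {s : Finset (Spacetime X)}
    (h : Enumerates l s) (hl' : l'.Pairwise (· < ·)) (hs : ∀ p ∈ l', p ∈ s) : l'.Sublist l := by
  classical
  obtain ⟨l'', hsub, hl''⟩ := h.exists_subset (t := l'.toFinset) fun p hp =>
    hs p (List.mem_toFinset.mp hp)
  have : Enumerates l' l'.toFinset := ⟨hl', fun p => List.mem_toFinset.symm⟩
  rwa [this.unique hl'']

/-- Sorting by time works: for comparable elements the causal order agrees with the order of times,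
since a relation against the order of times forces the distance to be zero. -/
theorem exists_enumerates {s : Finset (Spacetime X)}
    (hs : IsChain (· ≤ ·) (s : Set (Spacetime X))) : ∃ l, Enumerates l s := by
  classical
  let r : Spacetime X → Spacetime X → Prop := fun p q => p.time ≤ q.time
  have : Std.Total r := ⟨fun p q => le_total p.time q.time⟩
  have : IsTrans (Spacetime X) r := ⟨fun p q t => le_trans⟩
  have hperm := List.perm_insertionSort r s.toList
  have hmem : ∀ p, p ∈ s.toList.insertionSort r ↔ p ∈ s := fun p => by
    rw [hperm.mem_iff, Finset.mem_toList]
  refine ⟨s.toList.insertionSort r, ?_, hmem⟩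
  refine ((List.pairwise_insertionSort r s.toList).and
    (hperm.nodup_iff.mpr s.nodup_toList)).imp_of_mem fun {p q} hp hq h => ?_
  refine lt_of_le_of_ne ?_ h.2
  rcases hs.total ((hmem p).mp hp) ((hmem q).mp hq) with hpq | hqp
  · exact hpq
  · have h1 : dist q.point p.point ≤ p.time - q.time := hqp
    have h2 : p.time ≤ q.time := h.1
    have h3 := dist_nonneg (x := q.point) (y := p.point)
    change dist p.point q.point ≤ q.time - p.time
    rw [dist_comm]
    linarith

/-- A maximally long causal sequence joins the two ends of the causal interval. -/
theorem Enumerates.ends {a b : X} {ℓ : ℝ} {l : List (Spacetime X)} {s : Finset (Spacetime X)}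
    (he : Enumerates l s) (hs : s ∈ causalComplex a b ℓ) (hlen : ℓ ≤ pathLength (points l)) :
    l.head? = some ⟨a, 0⟩ ∧ l.getLast? = some ⟨b, ℓ⟩ := by
  have hmem : ∀ r ∈ l, r ∈ Cau a b ℓ := fun r hr => hs.2.1 ((he.2 r).mp hr)
  cases l with
  | nil =>
    obtain ⟨x, hx⟩ := hs.1
    exact absurd ((he.2 x).mpr hx) (by simp)
  | cons p l =>
    set q := (p :: l).getLast (by simp) with hq
    have hqmem : q ∈ p :: l := List.getLast_mem _
    have hle : ∀ r ∈ p :: l, r ≤ q := fun r hr => by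
      have h1 := he.1
      rw [← List.dropLast_append_getLast (l := p :: l) (by simp)] at hr h1
      rw [List.pairwise_append] at h1
      rcases List.mem_append.mp hr with hr | hr
      · exact (h1.2.2 r hr q (by simp [hq])).le
      · rw [List.mem_singleton.mp hr]
    -- The length is at most `q.time - p.time`, hence at most `ℓ - d(a, p) - d(q, b)`. As it is at
    -- least `ℓ`, both distances vanish and the times are extremal.
    have h1 := pathLength_points_le p q l he.1 hle
    have hp : dist a p.point ≤ p.time - 0 := (hmem p (by simp)).1
    have hb : dist q.point b ≤ ℓ - q.time := (hmem q hqmem).2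
    have hp0 := dist_nonneg (x := a) (y := p.point)
    have hb0 := dist_nonneg (x := q.point) (y := b)
    constructor
    · refine congrArg some (Spacetime.ext (dist_le_zero.mp ?_).symm ?_)
      · linarith
      · change p.time = 0; linarith
    · rw [List.getLast?_eq_getLast_of_ne_nil (by simp), ← hq]
      refine congrArg some (Spacetime.ext (dist_le_zero.mp ?_) ?_)
      · linarith
      · change q.time = ℓ; linarith

/-- The causal sequence that starts at time `t` and runs through the given points at unit speed. -/
def worldline : ℝ → List X → List (Spacetime X)
  | _, [] => []
  | t, [x] => [⟨x, t⟩]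
  | t, x :: y :: l => ⟨x, t⟩ :: worldline (t + dist x y) (y :: l)

theorem points_worldline : ∀ (t : ℝ) (l : List X), points (worldline t l) = l
  | _, [] => rfl
  | _, [_] => rfl
  | t, x :: y :: l => by
      have ih := points_worldline (t + dist x y) (y :: l)
      simp only [points, worldline, List.map_cons] at ih ⊢
      rw [ih]

theorem pairwise_worldline (t : ℝ) (l : List X) (hl : l.IsChain (· ≠ ·)) :
    (worldline t l).Pairwise (· < ·) := by
  rw [← List.isChain_iff_pairwise]
  induction l generalizing t with
  | nil => exact List.IsChain.nil
  | cons x l ih =>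
    cases l with
    | nil => exact List.IsChain.singleton _
    | cons y l =>
      rw [List.isChain_cons_cons] at hl
      have h1 : (⟨x, t⟩ : Spacetime X) < ⟨y, t + dist x y⟩ := by
        refine lt_of_le_of_ne ?_ fun h => hl.1 (congrArg Spacetime.point h)
        change dist x y ≤ t + dist x y - t
        linarith
      have h2 := ih (t + dist x y) hl.2
      cases l with
      | nil => exact List.isChain_cons_cons.mpr ⟨h1, h2⟩
      | cons z l => exact List.isChain_cons_cons.mpr ⟨h1, h2⟩

/-- Each link has length at most its time difference. Since the total length uses up all the
available time, every link is an equality, so the points determine the times. -/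
theorem eq_worldline : ∀ (p q : Spacetime X) (l : List (Spacetime X)),
    (p :: l).Pairwise (· < ·) → (∀ r ∈ p :: l, r ≤ q) →
    q.time - p.time ≤ pathLength (points (p :: l)) →
    p :: l = worldline p.time (points (p :: l))
  | p, q, [], _, _, _ => rfl
  | p, q, r :: l, h, hq, hlen => by
      rw [List.pairwise_cons] at h
      have hq' : ∀ s ∈ r :: l, s ≤ q := fun s hs => hq s (List.mem_cons_of_mem _ hs)
      have h1 := pathLength_points_le r q l h.2 hq'
      have h3 : dist p.point r.point ≤ r.time - p.time := (h.1 r (by simp)).le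
      simp only [points, List.map_cons, pathLength] at h1 hlen
      have ih := eq_worldline r q l h.2 hq' (by
        simp only [points, List.map_cons]; linarith)
      have ht : p.time + dist p.point r.point = r.time := by linarith
      simp only [points, List.map_cons, worldline] at ih ⊢
      rw [ht, ← ih]

theorem getElem?_worldline : ∀ (t : ℝ) (l : List X) (j : ℕ),
    (worldline t l)[j]? = l[j]?.map fun x => ⟨x, t + pathLength (l.take (j + 1))⟩
  | _, [], _ => by simp [worldline]
  | _, [x], 0 => by simp [worldline, pathLength]
  | _, [x], j + 1 => by simp [worldline]
  | _, x :: y :: l, 0 => by simp [worldline, pathLength]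
  | t, x :: y :: l, j + 1 => by
      have ih := getElem?_worldline (t + dist x y) (y :: l) j
      simp only [worldline, List.getElem?_cons_succ, ih, List.take_succ_cons, pathLength]
      congr 1
      funext z
      rw [add_assoc]

/-- In the causal interval of a pair of points at the distance `dist a b`, the short simplices are
those that do not contain both ends. -/
theorem mem_shortComplex_dist_iff {a b : X} (hab : a ≠ b) {s : Finset (Spacetime X)}
    (hs : s ∈ causalComplex a b (dist a b)) :
    s ∈ shortComplex a b (dist a b) ↔ ¬ (⟨a, 0⟩ ∈ s ∧ ⟨b, dist a b⟩ ∈ s) := by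
  constructor
  · rintro ⟨-, l, hl, hlen⟩ ⟨ha, hb⟩
    have hlt : (⟨a, 0⟩ : Spacetime X) < ⟨b, dist a b⟩ := by
      refine lt_of_le_of_ne ?_ fun h => hab (congrArg Spacetime.point h)
      change dist a b ≤ dist a b - 0
      linarith
    -- The two ends alone already have length `dist a b`, and further points cannot shorten the
    -- chain.
    have := pathLength_sublist ((hl.sublist (l' := [⟨a, 0⟩, ⟨b, dist a b⟩]) (by simpa using hlt)
      (by simp [ha, hb])).map Spacetime.point)
    simp only [List.map_cons, List.map_nil, pathLength, add_zero] at this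
    exact absurd this hlen.not_ge
  · intro h
    obtain ⟨l, hl⟩ := exists_enumerates hs.2.2
    refine ⟨hs, l, hl, lt_of_not_ge fun hlen => h ?_⟩
    obtain ⟨h1, h2⟩ := hl.ends hs hlen
    exact ⟨(hl.2 _).mp (List.mem_of_head? h1), (hl.2 _).mp (List.mem_of_getLast? h2)⟩

end Chains

/-! ### Frames as sets of events in the causal interval -/

section Frames

variable {X : Type u} [MetricSpace X] {a b : X} {ℓ : ℝ}

namespace Frame

/-- The point `aⱼ` of the frame `(a₀, …, aₘ)`, at the time `d(a₀, …, aⱼ)`. -/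
def event (F : Frame a b ℓ) (j : ℕ) : Spacetime X :=
  -- The first `j + 1` entries are `a₀, …, aⱼ`; the default value `a` occurs only for `j > F.steps`.
  ⟨F.toList.getD j a, pathLength (F.toList.take (j + 1))⟩

theorem length_eq_steps_add_one (F : Frame a b ℓ) : F.toList.length = F.steps + 1 := by
  have := List.length_pos_of_ne_nil F.isSingularSequence.1.1
  unfold steps
  omega

theorem steps_pos (F : Frame a b ℓ) (hℓ : 0 < ℓ) : 0 < F.steps := by
  have h := F.length_eq
  unfold steps
  match hl : F.toList with
  | [] => rw [hl] at h; simp only [pathLength] at h; linarith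
  | [_] => rw [hl] at h; simp only [pathLength] at h; linarith
  | _ :: _ :: _ => simp

theorem event_point (F : Frame a b ℓ) {j : ℕ} (hj : j < F.toList.length) :
    (F.event j).point = F.toList[j] :=
  List.getD_eq_getElem _ _ hj

theorem source_eq (F : Frame a b ℓ) (i : Fin F.steps) : F.source i = (F.event i).point :=
  (F.event_point _).symm

theorem target_eq (F : Frame a b ℓ) (i : Fin F.steps) : F.target i = (F.event (i + 1)).point :=
  (F.event_point _).symm

theorem event_zero (F : Frame a b ℓ) : F.event 0 = ⟨a, 0⟩ := by
  have h := F.head_eq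
  unfold event
  cases hl : F.toList with
  | nil => simp [hl] at h
  | cons x l =>
    simp only [hl, List.head?_cons, Option.some.injEq] at h
    simp [pathLength, h]

theorem event_steps (F : Frame a b ℓ) : F.event F.steps = ⟨b, ℓ⟩ := by
  have h := F.last_eq
  rw [List.getLast?_eq_getElem?] at h
  have h1 : F.toList.take (F.steps + 1) = F.toList :=
    List.take_of_length_le F.length_eq_steps_add_one.le
  rw [event, h1, F.length_eq, List.getD_eq_getElem?_getD, steps, h]
  rfl

theorem event_succ_time (F : Frame a b ℓ) {j : ℕ} (hj : j < F.steps) :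
    (F.event (j + 1)).time =
      (F.event j).time + dist (F.event j).point (F.event (j + 1)).point := by
  have hlen := F.length_eq_steps_add_one
  rw [F.event_point (by omega), F.event_point (by omega)]
  exact pathLength_take_add_two _ _ (by omega)

theorem event_point_ne (F : Frame a b ℓ) {j : ℕ} (hj : j < F.steps) :
    (F.event j).point ≠ (F.event (j + 1)).point := by
  have hlen := F.length_eq_steps_add_one
  rw [F.event_point (by omega), F.event_point (by omega)]
  exact List.isChain_iff_getElem.mp F.isSingularSequence.1.2 j (by omega)

theorem event_lt_succ (F : Frame a b ℓ) {j : ℕ} (hj : j < F.steps) :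
    F.event j < F.event (j + 1) := by
  refine lt_of_le_of_ne ?_ fun h => F.event_point_ne hj (congrArg Spacetime.point h)
  change dist _ _ ≤ _
  rw [F.event_succ_time hj]
  linarith

theorem event_lt_of_lt (F : Frame a b ℓ) {j k : ℕ} (hjk : j < k) (hk : k ≤ F.steps) :
    F.event j < F.event k := by
  induction k, hjk using Nat.le_induction with
  | base => exact F.event_lt_succ hk
  | succ k hjk ih => exact (ih (by omega)).trans (F.event_lt_succ hk)

theorem event_mono (F : Frame a b ℓ) {j k : ℕ} (hjk : j ≤ k) (hk : k ≤ F.steps) :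
    F.event j ≤ F.event k := by
  rcases hjk.eq_or_lt with rfl | hjk
  · exact le_rfl
  · exact (F.event_lt_of_lt hjk hk).le

theorem mem_worldline (F : Frame a b ℓ) {v : Spacetime X} :
    v ∈ worldline 0 F.toList ↔ ∃ j ≤ F.steps, F.event j = v := by
  have hlen := F.length_eq_steps_add_one
  rw [List.mem_iff_getElem?]
  refine exists_congr fun j => ?_
  rw [getElem?_worldline, Option.map_eq_some_iff]
  constructor
  · rintro ⟨x, hx, rfl⟩
    obtain ⟨hj, rfl⟩ := List.getElem?_eq_some_iff.mp hx
    exact ⟨by omega, Spacetime.ext (F.event_point hj) (zero_add _).symm⟩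
  · rintro ⟨hj, rfl⟩
    exact ⟨_, List.getElem?_eq_getElem (by omega),
      Spacetime.ext (F.event_point (by omega)).symm (zero_add _)⟩

/-- A simplex has the frame `F` if and only if it contains all events of `F`. -/
theorem mem_framedSimplices_iff (F : Frame a b ℓ) (hℓ : (ℓ : EReal) < fourCutInf X)
    {s : Finset (Spacetime X)} (hs : s ∈ causalComplex a b ℓ) :
    s ∈ framedSimplices F ↔ ∀ j ≤ F.steps, F.event j ∈ s := by
  have hF := F.isSingularSequence.1
  constructor
  · rintro ⟨-, l, hl, hlF⟩
    -- The frame lifts to a subchain `l'` with points `F`. Its length `ℓ` fills the whole interval,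
    -- so it must be the worldline of `F` that starts at time `0`.
    obtain ⟨l', hsub, hl'⟩ := List.sublist_map_iff.mp (hlF ▸ frame_sublist (points l))
    have hmem : ∀ r ∈ l', r ∈ Cau a b ℓ := fun r hr => hs.2.1 ((hl.2 r).mp (hsub.subset hr))
    have hl'w : l' = worldline 0 F.toList := by
      cases l' with
      | nil => exact absurd hl' hF.1
      | cons p l' =>
        have hq : ∀ r ∈ p :: l', r ≤ (⟨b, ℓ⟩ : Spacetime X) := fun r hr => (hmem r hr).2
        have hlen : pathLength (points (p :: l')) = ℓ := by
          rw [points, ← hl', F.length_eq]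
        have h1 := pathLength_points_le p ⟨b, ℓ⟩ l' (hl.1.sublist hsub) hq
        have h2 : dist a p.point ≤ p.time - 0 := (hmem p (by simp)).1
        have h3 := dist_nonneg (x := a) (y := p.point)
        have h0 : p.time = 0 := by simp only at h1; linarith
        have h4 := eq_worldline p ⟨b, ℓ⟩ l' (hl.1.sublist hsub) hq (by
          simp only; linarith)
        rw [h0] at h4
        rw [h4, hl']
        rfl
    intro j hj
    rw [← hl.2]
    exact hsub.subset (hl'w ▸ F.mem_worldline.mpr ⟨j, hj, rfl⟩)
  · intro h
    obtain ⟨l, hl⟩ := exists_enumerates hs.2.2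
    -- Conversely, the worldline of `F` is a subchain whose length `ℓ` is the maximal one, so the
    -- whole chain has the same frame as `F`, and a singular sequence is its own frame.
    have hsub := (hl.sublist (pairwise_worldline 0 F.toList hF.2) fun p hp => by
      obtain ⟨j, hj, rfl⟩ := F.mem_worldline.mp hp
      exact h j hj).map Spacetime.point
    have hb := causal_bounds hl hs
    change (points (worldline 0 F.toList)).Sublist (points l) at hsub
    rw [points_worldline] at hsub
    have hle := pathLength_sublist hsub
    rw [F.length_eq] at hle
    refine ⟨hs, l, hl, ?_⟩
    rw [← frame_eq_of_sublist hsub (hb.2 hle) hF.2 hF.1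
      (by rw [F.length_eq]; exact le_antisymm hle hb.1) (by rwa [le_antisymm hb.1 hle]),
      F.isSingularSequence.frame_eq]

theorem notMem_shortComplex_of_mem_framedSimplices (F : Frame a b ℓ) {s : Finset (Spacetime X)}
    (hs : s ∈ framedSimplices F) : s ∉ shortComplex a b ℓ := by
  rintro ⟨-, l', hl', hlen⟩
  obtain ⟨-, l, hl, hlF⟩ := hs
  have := pathLength_sublist (frame_sublist (points l))
  rw [hlF, F.length_eq, hl.unique hl'] at this
  exact absurd this hlen.not_ge

theorem mem_causalComplex_of_mem_framedComplex {hℓ : (ℓ : EReal) < fourCutInf X}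
    (F : Frame a b ℓ) {s : Finset (Spacetime X)} (hs : s ∈ framedComplex hℓ F) :
    s ∈ causalComplex a b ℓ := by
  rcases hs with hs | hs <;> exact hs.1

theorem mem_shortComplex_iff {hℓ : (ℓ : EReal) < fourCutInf X} (F : Frame a b ℓ)
    {s : Finset (Spacetime X)} (hs : s ∈ framedComplex hℓ F) :
    s ∈ shortComplex a b ℓ ↔ ¬ ∀ j ≤ F.steps, F.event j ∈ s := by
  rw [← F.mem_framedSimplices_iff hℓ (F.mem_causalComplex_of_mem_framedComplex hs)]
  refine ⟨fun h h' => F.notMem_shortComplex_of_mem_framedSimplices h' h, fun h => ?_⟩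
  exact hs.resolve_left h

theorem eq_of_mem_framedComplex {hℓ : (ℓ : EReal) < fourCutInf X} {F F' : Frame a b ℓ}
    {s : Finset (Spacetime X)} (hsL : s ∉ shortComplex a b ℓ) (hs : s ∈ framedComplex hℓ F)
    (hs' : s ∈ framedComplex hℓ F') : F = F' := by
  obtain ⟨-, l, hl, hlF⟩ := hs.resolve_right hsL
  obtain ⟨-, l', hl', hlF'⟩ := hs'.resolve_right hsL
  ext1
  rw [← hlF, ← hlF', hl.unique hl']

/-- A simplex that is not short has length exactly `ℓ`, so its points form a sequence from `a` to
`b`; the frame of that sequence is the required `F`. -/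
theorem exists_mem_framedComplex (hℓ : (ℓ : EReal) < fourCutInf X) {s : Finset (Spacetime X)}
    (hs : s ∈ causalComplex a b ℓ) (hsL : s ∉ shortComplex a b ℓ) :
    ∃ F : Frame a b ℓ, s ∈ framedComplex hℓ F := by
  obtain ⟨l, hl⟩ := exists_enumerates hs.2.2
  have hlen : ℓ ≤ pathLength (points l) := le_of_not_gt fun h => hsL ⟨hs, l, hl, h⟩
  have hb := causal_bounds hl hs
  have heq := le_antisymm hb.1 hlen
  obtain ⟨hhead, hlast⟩ := hl.ends hs hlen
  have hhead' : (points l).head? = some a := by simp [points, List.head?_map, hhead]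
  have hlast' : (points l).getLast? = some b := by simp [points, List.getLast?_map, hlast]
  have hsing := isSingularSequence_frame (points l)
    ⟨fun h => by simp [h] at hhead', hb.2 hlen⟩ (heq ▸ hℓ)
  exact ⟨⟨frame (points l), hsing.1, (head?_frame _).trans hhead', (getLast?_frame _).trans hlast',
    hsing.2.trans heq⟩, Or.inl ⟨hs, l, hl, rfl⟩⟩

end Frame

/-! ### Cutting chains at the events of the frame and gluing them back -/

/-- The translation in time. -/
def Spacetime.shift (t : ℝ) (p : Spacetime X) : Spacetime X :=
  ⟨p.point, p.time + t⟩

omit [MetricSpace X] in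
theorem Spacetime.shift_injective (t : ℝ) : Function.Injective (Spacetime.shift (X := X) t) :=
  fun p q h => by
    rw [Spacetime.ext_iff] at h ⊢
    exact ⟨h.1, add_right_cancel h.2⟩

theorem Spacetime.shift_le_shift_iff {t : ℝ} {p q : Spacetime X} :
    p.shift t ≤ q.shift t ↔ p ≤ q := by
  change dist p.point q.point ≤ q.time + t - (p.time + t) ↔ dist p.point q.point ≤ q.time - p.time
  rw [add_sub_add_right_eq_sub]

namespace Frame

variable (F : Frame a b ℓ)

/-- The translation in time that moves the start of the `i`-th step to the time at which the frame
passes through it. -/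
def stepShift (i : Fin F.steps) : Spacetime X → Spacetime X :=
  Spacetime.shift (F.event i).time

theorem stepShift_source (i : Fin F.steps) : F.stepShift i ⟨F.source i, 0⟩ = F.event i :=
  Spacetime.ext (F.source_eq i) (zero_add _)

theorem stepShift_target (i : Fin F.steps) :
    F.stepShift i ⟨F.target i, dist (F.source i) (F.target i)⟩ = F.event (i + 1) := by
  refine Spacetime.ext (F.target_eq i) ?_
  rw [F.event_succ_time i.2, ← F.source_eq, ← F.target_eq, add_comm]
  rfl

theorem mem_Cau_step_iff (i : Fin F.steps) {x : Spacetime X} :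
    x ∈ Cau (F.source i) (F.target i) (dist (F.source i) (F.target i)) ↔
      F.event i ≤ F.stepShift i x ∧ F.stepShift i x ≤ F.event (i + 1) := by
  rw [← stepShift_source, ← stepShift_target]
  exact and_congr Spacetime.shift_le_shift_iff.symm Spacetime.shift_le_shift_iff.symm

theorem stepShift_mem_Cau {i : Fin F.steps} {x : Spacetime X}
    (hx : x ∈ Cau (F.source i) (F.target i) (dist (F.source i) (F.target i))) :
    F.stepShift i x ∈ Cau a b ℓ := by
  rw [mem_Cau_step_iff] at hx
  rw [Cau, ← F.event_zero, ← F.event_steps]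
  exact ⟨(F.event_mono (Nat.zero_le _) i.2.le).trans hx.1, hx.2.trans (F.event_mono i.2 le_rfl)⟩

theorem source_ne_target (i : Fin F.steps) : F.source i ≠ F.target i := by
  rw [source_eq, target_eq]
  exact F.event_point_ne i.2

theorem left_mem_Cau (x y : X) : (⟨x, 0⟩ : Spacetime X) ∈ Cau x y (dist x y) :=
  ⟨le_rfl, show dist x y ≤ dist x y - 0 by simp⟩

theorem right_mem_Cau (x y : X) : (⟨y, dist x y⟩ : Spacetime X) ∈ Cau x y (dist x y) :=
  ⟨show dist x y ≤ dist x y - 0 by simp, le_rfl⟩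

/-- Every event but the last starts a step. The last one ends the final step, which exists because
`0 < ℓ`. -/
theorem forall_event_mem_iff (hpos : 0 < ℓ) {s : Finset (Spacetime X)} :
    (∀ j ≤ F.steps, F.event j ∈ s) ↔ ∀ i : Fin F.steps,
      F.stepShift i ⟨F.source i, 0⟩ ∈ s ∧
        F.stepShift i ⟨F.target i, dist (F.source i) (F.target i)⟩ ∈ s := by
  simp only [stepShift_source, stepShift_target]
  refine ⟨fun h i => ⟨h _ i.2.le, h _ i.2⟩, fun h j hj => ?_⟩
  rcases hj.eq_or_lt with rfl | hj
  · have h0 := F.steps_pos hpos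
    have := (h ⟨F.steps - 1, by omega⟩).2
    rwa [show F.steps - 1 + 1 = F.steps by omega] at this
  · exact (h ⟨j, hj⟩).1

/-- Every element of a simplex that contains the events of `F` lies between two successive
events. -/
theorem exists_stepShift_eq (hpos : 0 < ℓ) {s : Finset (Spacetime X)}
    (hs : s ∈ causalComplex a b ℓ) (hF : ∀ j ≤ F.steps, F.event j ∈ s) {v : Spacetime X}
    (hv : v ∈ s) : ∃ i : Fin F.steps,
      ∃ x ∈ Cau (F.source i) (F.target i) (dist (F.source i) (F.target i)),
        F.stepShift i x = v := by
  classical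
  have hsteps := F.steps_pos hpos
  have hvC : v ∈ Cau a b ℓ := hs.2.1 hv
  rw [Cau, ← F.event_zero, ← F.event_steps] at hvC
  -- The last event not after `v`, searched only up to `F.steps - 1` so that a next event exists.
  -- That next event is comparable with `v` because both lie in the chain `s`.
  set i := Nat.findGreatest (fun j => F.event j ≤ v) (F.steps - 1) with hi
  have h1 : F.event i ≤ v :=
    Nat.findGreatest_spec (P := fun j => F.event j ≤ v) (Nat.zero_le _) hvC.1
  have hi' : i ≤ F.steps - 1 := Nat.findGreatest_le _
  have h2 : v ≤ F.event (i + 1) := by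
    rcases hi'.eq_or_lt with h | h
    · rw [show i + 1 = F.steps by omega]
      exact hvC.2
    · exact (hs.2.2.total hv (hF (i + 1) (by omega))).resolve_right
        (Nat.findGreatest_is_greatest (P := fun j => F.event j ≤ v) (n := F.steps - 1)
          (Nat.lt_succ_self _) h)
  refine ⟨⟨i, by omega⟩, ⟨v.point, v.time - (F.event i).time⟩, ?_, ?_⟩
  · rw [mem_Cau_step_iff]
    have : F.stepShift ⟨i, by omega⟩ ⟨v.point, v.time - (F.event i).time⟩ = v :=
      Spacetime.ext rfl (sub_add_cancel _ _)
    rw [this]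
    exact ⟨h1, h2⟩
  · exact Spacetime.ext rfl (sub_add_cancel _ _)

/-- The complex `S(X; F) ∪ Δ̇ Cau` is glued from the complexes of the steps of `F`. -/
theorem isGlued (hpos : 0 < ℓ) (hℓ : (ℓ : EReal) < fourCutInf X) :
    IsGlued (framedComplex hℓ F) (shortComplex a b ℓ)
      (fun i => causalComplex (F.source i) (F.target i) (dist (F.source i) (F.target i)))
      (fun i => shortComplex (F.source i) (F.target i) (dist (F.source i) (F.target i)))
      (fun i => Cau (F.source i) (F.target i) (dist (F.source i) (F.target i)))
      F.stepShift (fun i => ⟨F.source i, 0⟩)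
      (fun i => ⟨F.target i, dist (F.source i) (F.target i)⟩) where
  pos := F.steps_pos hpos
  injective i := Spacetime.shift_injective _
  left_mem i := left_mem_Cau _ _
  right_mem i := right_mem_Cau _ _
  subset i s hs x hx := hs.2.1 hx
  join i k hik := by rw [stepShift_source, stepShift_target, hik]
  overlap i k hik x hx y hy hxy := by
    have hx' := (F.mem_Cau_step_iff i).mp hx
    have hy' := (F.mem_Cau_step_iff k).mp hy
    -- The common image lies before event `i + 1` and after event `k`. As `i < k`, these two events
    -- coincide and the image equals them.
    have h1 : F.event k ≤ F.event (i + 1) := hy'.1.trans (hxy ▸ hx'.2)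
    have h2 : F.event (i + 1) ≤ F.event k := F.event_mono hik k.2.le
    have hk : k.val = i.val + 1 := by
      by_contra hne
      have hlt : i.val + 1 < k.val := lt_of_le_of_ne hik (Ne.symm hne)
      exact (F.event_lt_of_lt hlt k.2.le).not_ge h1
    have h3 : F.stepShift i x = F.event (i + 1) :=
      le_antisymm hx'.2 (h2.trans (hxy ▸ hy'.1))
    refine ⟨hk, Spacetime.shift_injective (F.event i).time (h3.trans (F.stepShift_target i).symm),
      Spacetime.shift_injective (F.event k).time ?_⟩
    change F.stepShift k y = F.stepShift k _
    rw [stepShift_source, ← hxy, h3, hk]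
  mem_short_piece i s hs := mem_shortComplex_dist_iff (F.source_ne_target i) hs
  exists_short_piece i := by
    have hs : {⟨F.source i, 0⟩} ∈
        causalComplex (F.source i) (F.target i) (dist (F.source i) (F.target i)) :=
      ⟨Finset.singleton_nonempty _, by simpa using left_mem_Cau _ _, by simp⟩
    refine ⟨_, hs, (mem_shortComplex_dist_iff (F.source_ne_target i) hs).mpr fun h => ?_⟩
    exact F.source_ne_target i (congrArg Spacetime.point (Finset.mem_singleton.mp h.2)).symm
  mem_short s hs := by rw [F.mem_shortComplex_iff hs, F.forall_event_mem_iff hpos]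
  piece s hs hsL i t ht := by
    have hsc := F.mem_causalComplex_of_mem_framedComplex hs
    rw [F.mem_shortComplex_iff hs, not_not] at hsL
    refine ⟨⟨_, (ht _).mpr ⟨left_mem_Cau _ _, ?_⟩⟩, fun x hx => ((ht x).mp hx).1, ?_⟩
    · rw [stepShift_source]
      exact hsL _ i.2.le
    · intro x hx y hy hxy
      exact (hsc.2.2 ((ht x).mp hx).2 ((ht y).mp hy).2
        fun h => hxy (Spacetime.shift_injective _ h)).imp
        Spacetime.shift_le_shift_iff.mp Spacetime.shift_le_shift_iff.mp
  covered s hs hsL v hv := by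
    rw [F.mem_shortComplex_iff hs, not_not] at hsL
    exact F.exists_stepShift_eq hpos (F.mem_causalComplex_of_mem_framedComplex hs) hsL hv
  glue s hs t ht := by
    have hends : ∀ i, (⟨F.source i, 0⟩ : Spacetime X) ∈ s i ∧
        (⟨F.target i, dist (F.source i) (F.target i)⟩ : Spacetime X) ∈ s i := fun i => by
      have := (hs i).2
      rwa [mem_shortComplex_dist_iff (F.source_ne_target i) (hs i).1, not_not] at this
    have hcau : ∀ i, ∀ x ∈ s i, x ∈ Cau (F.source i) (F.target i)
        (dist (F.source i) (F.target i)) := fun i x hx => (hs i).1.2.1 hx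
    -- Elements of different pieces are comparable because an event of `F` lies between them; so the
    -- union of the pieces is a chain.
    have hlt : ∀ i k, i < k → ∀ x ∈ s i, ∀ y ∈ s k, F.stepShift i x ≤ F.stepShift k y :=
      fun i k hik x hx y hy => ((F.mem_Cau_step_iff i).mp (hcau i x hx)).2.trans
        ((F.event_mono hik k.2.le).trans ((F.mem_Cau_step_iff k).mp (hcau k y hy)).1)
    have hF : ∀ j ≤ F.steps, F.event j ∈ t := by
      rw [F.forall_event_mem_iff hpos]
      exact fun i => ⟨(ht _).mpr ⟨i, _, (hends i).1, rfl⟩, (ht _).mpr ⟨i, _, (hends i).2, rfl⟩⟩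
    have htc : t ∈ causalComplex a b ℓ := by
      refine ⟨⟨_, hF 0 (Nat.zero_le _)⟩, fun v hv => ?_, fun v hv w hw _ => ?_⟩
      · obtain ⟨i, x, hx, rfl⟩ := (ht v).mp hv
        exact F.stepShift_mem_Cau (hcau i x hx)
      · obtain ⟨i, x, hx, rfl⟩ := (ht v).mp hv
        obtain ⟨k, y, hy, rfl⟩ := (ht w).mp hw
        rcases lt_trichotomy i k with hik | rfl | hik
        · exact Or.inl (hlt i k hik x hx y hy)
        · exact ((hs i).1.2.2.total hx hy).imp Spacetime.shift_le_shift_iff.mpr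
            Spacetime.shift_le_shift_iff.mpr
        · exact Or.inr (hlt k i hik y hy x hx)
    exact Or.inl ((F.mem_framedSimplices_iff hℓ htc).mpr hF)

end Frame

end Frames

end MagnitudeHomotopy

end

theorem mainTheorem7 {X : Type*} [MetricSpace X] (a b : X) (ℓ : ℝ) (hpos : 0 < ℓ)
    (hℓ : (ℓ : EReal) < MagnitudeHomotopy.fourCutInf X) (hab : dist a b ≤ ℓ) :
    MagnitudeHomotopy.PointedHomeomorphic
      (MagnitudeHomotopy.MagnitudeType.pt a b ℓ)
      (MagnitudeHomotopy.Wedge.pt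
        fun F : MagnitudeHomotopy.Frame a b ℓ => MagnitudeHomotopy.FramedType.pt hℓ F) ∧
    ∀ F : MagnitudeHomotopy.Frame a b ℓ,
      MagnitudeHomotopy.PointedHomotopyEquivalent
        (MagnitudeHomotopy.FramedType.pt hℓ F)
        (MagnitudeHomotopy.Smash.pt
          fun i : Fin F.steps =>
            MagnitudeHomotopy.MagnitudeType.pt (F.source i) (F.target i)
              (dist (F.source i) (F.target i))) :=
  ⟨⟨MagnitudeHomotopy.homeomorphWedge
      (fun F _ hs => F.mem_causalComplex_of_mem_framedComplex hs)
      (fun _ hs hsL => MagnitudeHomotopy.Frame.exists_mem_framedComplex hℓ hs hsL)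
      (fun _ hsL _ _ hs hs' => MagnitudeHomotopy.Frame.eq_of_mem_framedComplex hsL hs hs'), rfl⟩,
    fun F => MagnitudeHomotopy.PointedHomeomorphic.pointedHomotopyEquivalent
      ⟨(F.isGlued hpos hℓ).homeomorphSmash, rfl⟩⟩
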